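/- Let $K$ be a field of characteristic $0$, $E$ a finite-dimensional $K$-vector space, and $V=E\oplus E^*$ the superspace with $E$ in degree $0$ and $E^*$ in degree $1$. Let $\mathfrak{pe}(V)\subset\mathfrak{gl}(V)$ be the periplectic Lie superalgebra of all endomorphisms of $V$ whose block $E^*\to E^*$ is minus the transpose of the block $E\to E$, whose block $E^*\to E$ (of degree $-1$) is symmetric, and whose block $E\to E^*$ (of degree $1$) is skew-symmetric. For partitions $\mu\subseteq\lambda$ let $\mathbf{S}_{\lambda/\mu}V$ (and $\mathbf{S}_\lambda V$ for $\mu=\emptyset$) be the Schur complex of $V$, i.e. the image of the Schur map $\bigwedge^{\lambda/\mu}V\to \mathrm{S}^{\lambda/\mu}V$ from the tensor product of the exterior powers of $V$ over the columns of $\lambda/\mu$ to the tensor product of the symmetric powers of $V$ over its rows (in the super sense). It is a $\mathbf{Z}$-graded representation of $\mathfrak{pe}(V)$, whose part of homological degree $d$ consists of the tensors with exactly $d$ factors from $E^*$. For a $\mathbf Z$-graded representation $M$ let $M[1]=K[1]\otimes M$ with $K[1]$ the trivial one-dimensional representation placed in homological degree $1$; so $M[1]_d=M_{d-1}$, and a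 homogeneous $X$ acts on $M[1]$ as $(-1)^{|X|}$ times its action on $M$. Let the trace $K[1]\to\bigwedge^2V$ be the map with image spanned by $\sum_i e_i\wedge e_i^*$ (for a basis $(e_i)$ of $E$ with dual basis $(e_i^*)$), and let the evaluation $\mathrm{S}^2V\to K[1]$ be the map given by the pairing of $E$ with $E^*$ and zero on $\mathrm{S}^2E$ and on $\bigwedge^2E^*$. Let $\lambda$ be a partition, and $\lambda^\dagger$ its transpose. (a) If $(1,1)\subseteq\lambda$, the map $\bigwedge^{\lambda/(1,1)}V[1]\to\bigwedge^\lambda V$ given by the trace and the multiplication into the first column induces a $\mathfrak{pe}(V)$-equivariant morphism of degree $0$ $$(\mathbf{S}_{\lambda/(1,1)}V)[1]\to\mathbf{S}_\lambda V .$$ (b) If $(2)\subseteq\lambda$, the map $\mathrm{S}^\lambda V\to \mathrm{S}^{\lambda/(2)}V[1]$ given by the comultiplication of the first row and the evaluation induces (restricts to) a $\mathfrak{pe}(V)$-equivariant morphism of degree $0$ $$\mathbf{S}_\lambda V\to(\mathbf{S}_{\lambda/(2)}V)[1].$$ Suppose moreover that $\lambda^\dagger_1\le\dim E+1$ and $\lambda^\dagger_2\le\dim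 E$ (that is, $(\mathbf{S}_\lambda V)_1\ne0$ when $\lambda\neq\emptyset$). Then both morphisms, when defined, are nonzero in homological degree $0$: the first one is nonzero on $(\mathbf{S}_{\lambda/(1,1)}V)_0$ (it maps it to $(\mathbf{S}_\lambda V)_1$), and the second one, from $(\mathbf{S}_\lambda V)_1$ to $(\mathbf{S}_{\lambda/(2)}V)_0$, is nonzero. -/

import Mathlib

open scoped TensorProduct

namespace Periplectic

/-! ## The superspace `V = E ⊕ E*` and the Lie superalgebra `pe(V)` -/

/-- The superspace `V = E ⊕ E*`, with `E` in degree `0` and `E*` in degree `1`. -/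
abbrev Vec (K E : Type*) [Field K] [AddCommGroup E] [Module K E] : Type _ :=
  E × Module.Dual K E

section Superspace

variable (K E : Type*) [Field K] [AddCommGroup E] [Module K E]

/-- The projection of `V` onto its homogeneous component: onto `E` (degree `0`) for `false`,
onto `E*` (degree `1`) for `true`. -/
def proj : Bool → (Vec K E →ₗ[K] Vec K E)
  | false => LinearMap.inl K E (Module.Dual K E) ∘ₗ LinearMap.fst K E (Module.Dual K E)
  | true => LinearMap.inr K E (Module.Dual K E) ∘ₗ LinearMap.snd K E (Module.Dual K E)

/-- The parity involution `v ↦ (-1)^{|v|} v` of `V`. -/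
def parityInv : Vec K E →ₗ[K] Vec K E := proj K E false - proj K E true

variable {K E}

/-- The even component (degree `0`) of an endomorphism of `V`. -/
def evenPart (X : Vec K E →ₗ[K] Vec K E) : Vec K E →ₗ[K] Vec K E :=
  ∑ p : Bool, proj K E p ∘ₗ X ∘ₗ proj K E p

/-- The odd component (degrees `1` and `-1`) of an endomorphism of `V`. -/
def oddPart (X : Vec K E →ₗ[K] Vec K E) : Vec K E →ₗ[K] Vec K E :=
  ∑ p : Bool, proj K E (!p) ∘ₗ X ∘ₗ proj K E p

/-- `X ↦ (-1)^{|X|} X` on endomorphisms of `V`, i.e. `X` on even and `-X` on odd ones. -/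
def signTwist (X : Vec K E →ₗ[K] Vec K E) : Vec K E →ₗ[K] Vec K E :=
  evenPart X - oddPart X

variable (K E)

/-- The periplectic Lie superalgebra `pe(V)` inside `gl(V)`.  An endomorphism of `V = E ⊕ E*` is a
block matrix with blocks `E → E`, `E* → E` (degree `-1`), `E → E*` (degree `1`), `E* → E*`; it is
in `pe(V)` when the block `E* → E*` is minus the transpose of the block `E → E`, the block
`E* → E` is symmetric (an element of `S² E`) and the block `E → E*` is skew-symmetric (an element
of `⋀² E*`). -/
def periplectic : Submodule K (Vec K E →ₗ[K] Vec K E) where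
  carrier := {X |
    (∀ (e : E) (φ : Module.Dual K E), (X (0, φ)).2 e = - φ (X (e, 0)).1) ∧
    (∀ φ ψ : Module.Dual K E, ψ (X (0, φ)).1 = φ (X (0, ψ)).1) ∧
    (∀ e e' : E, (X (e, 0)).2 e' = - (X (e', 0)).2 e)}
  add_mem' := by
    rintro X Y ⟨h1, h2, h3⟩ ⟨k1, k2, k3⟩
    refine ⟨fun e φ => ?_, fun φ ψ => ?_, fun e e' => ?_⟩
    · simp [h1 e φ, k1 e φ]; ring
    · simp [h2 φ ψ, k2 φ ψ]
    · simp [h3 e e', k3 e e']; ring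
  zero_mem' := by simp
  smul_mem' := by
    rintro c X ⟨h1, h2, h3⟩
    refine ⟨fun e φ => ?_, fun φ ψ => ?_, fun e e' => ?_⟩
    · simp [h1 e φ]
    · simp [h2 φ ψ]
    · simp [h3 e e']

end Superspace

/-! ## Tensor powers of `V`, indexed by a finite totally ordered set -/

section Tensor

variable (K E : Type*) [Field K] [AddCommGroup E] [Module K E]
variable (B : Type*) [Fintype B] [LinearOrder B]

/-- The tensor power `V^{⊗ B}`; the order of `B` is the order of the tensor factors. -/
abbrev TPow : Type _ := ⨂[K] _ : B, Vec K E

variable {B}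

/-- The projection of `V^{⊗ B}` onto the span of the tensors whose factors in `S` are odd
and whose other factors are even. -/
noncomputable def tensorProj (S : Finset B) : TPow K E B →ₗ[K] TPow K E B :=
  PiTensorProduct.map (fun b => proj K E (decide (b ∈ S)))

variable (B) in
/-- The part of `V^{⊗ B}` of homological degree `d`: exactly `d` factors lie in `E*`. -/
noncomputable def tensorPart (d : ℤ) : Submodule K (TPow K E B) :=
  LinearMap.range (∑ S : Finset B with (S.card : ℤ) = d, tensorProj K E S)

/-- The Koszul sign of moving the tensor factor at `b` to the position `σ b`, for all `b`, when the
odd factors are those in `S`. -/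
def koszulSign (σ : Equiv.Perm B) (S : Finset B) : ℤ :=
  ∏ i ∈ S, ∏ j ∈ S, if i < j ∧ σ j < σ i then -1 else 1

/-- The action of the permutation `σ` on `V^{⊗ B}`, with the Koszul sign rule. -/
noncomputable def signedPerm (σ : Equiv.Perm B) : TPow K E B →ₗ[K] TPow K E B :=
  ∑ S : Finset B, (koszulSign σ S : K) •
    ((PiTensorProduct.reindex K (fun _ : B => Vec K E) σ).toLinearMap ∘ₗ tensorProj K E S)

variable {K E}

/-- `∑_b T ⊗ ⋯ ⊗ T ⊗ Y ⊗ 1 ⊗ ⋯ ⊗ 1`, with `Y` in position `b`. -/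
noncomputable def tensorDer (T Y : Vec K E →ₗ[K] Vec K E) : TPow K E B →ₗ[K] TPow K E B :=
  ∑ b : B, PiTensorProduct.map
    (fun c => if c < b then T else if c = b then Y else LinearMap.id)

/-- The action of `X ∈ gl(V)` on `V^{⊗ B}` with the Koszul sign rule: for homogeneous `X`,
`X (v₁ ⊗ v₂ ⊗ ⋯) = X v₁ ⊗ v₂ ⊗ ⋯ + (-1)^{|X| |v₁|} v₁ ⊗ X v₂ ⊗ ⋯ + ⋯`. -/
noncomputable def tensorAct (X : Vec K E →ₗ[K] Vec K E) : TPow K E B →ₗ[K] TPow K E B :=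
  tensorDer LinearMap.id (evenPart X) + tensorDer (parityInv K E) (oddPart X)

/-! The signed permutations commute with the action of `gl(V)`. -/

/-- The factors of the pure tensor `x` are homogeneous, and odd exactly on `S`. -/
def IsHomog (S : Finset B) (x : B → Vec K E) : Prop :=
  ∀ c, proj K E (decide (c ∈ S)) (x c) = x c

theorem proj_proj (p q : Bool) (v : Vec K E) :
    proj K E p (proj K E q v) = if p = q then proj K E q v else 0 := by
  cases p <;> cases q <;> simp [proj]

theorem sum_proj (v : Vec K E) : ∑ p : Bool, proj K E p v = v := by
  simp [proj]

theorem evenPart_proj (X : Vec K E →ₗ[K] Vec K E) (p : Bool) (v : Vec K E) :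
    proj K E p (evenPart X (proj K E p v)) = evenPart X (proj K E p v) := by
  cases p <;> simp [evenPart, proj, Prod.mk_zero_zero]

theorem oddPart_proj (X : Vec K E →ₗ[K] Vec K E) (p : Bool) (v : Vec K E) :
    proj K E (!p) (oddPart X (proj K E p v)) = oddPart X (proj K E p v) := by
  cases p <;> simp [oddPart, proj, Prod.mk_zero_zero]

theorem tensorProj_tprod {S : Finset B} {x : B → Vec K E} (hx : IsHomog S x) (S' : Finset B) :
    tensorProj K E S' (PiTensorProduct.tprod K x) =
      if S' = S then PiTensorProduct.tprod K x else 0 := by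
  rw [tensorProj, PiTensorProduct.map_tprod]
  split_ifs with h
  · subst h
    congr 1
    funext c
    exact hx c
  · obtain ⟨c, hc⟩ : ∃ c, ¬ (c ∈ S' ↔ c ∈ S) := by
      by_contra hcon
      push Not at hcon
      exact h (Finset.ext hcon)
    refine MultilinearMap.map_coord_zero _ c ?_
    rw [← hx c, proj_proj, if_neg]
    simpa using hc

theorem signedPerm_tprod (σ : Equiv.Perm B) {S : Finset B} {x : B → Vec K E}
    (hx : IsHomog S x) :
    signedPerm K E σ (PiTensorProduct.tprod K x) =
      (koszulSign σ S : K) • PiTensorProduct.tprod K (fun c => x (σ.symm c)) := by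
  rw [signedPerm, LinearMap.sum_apply, Finset.sum_eq_single S]
  · simp only [LinearMap.smul_apply, LinearMap.comp_apply, LinearEquiv.coe_coe]
    rw [tensorProj_tprod hx, if_pos rfl, PiTensorProduct.reindex_tprod]
  · intro S' _ h
    simp only [LinearMap.smul_apply, LinearMap.comp_apply]
    rw [tensorProj_tprod hx, if_neg h, map_zero, smul_zero]
  · simp

set_option linter.unusedSectionVars false in
theorem IsHomog.perm {S : Finset B} {x : B → Vec K E} (hx : IsHomog S x) (σ : Equiv.Perm B) :
    IsHomog (S.map σ.toEmbedding) (fun c => x (σ.symm c)) := by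
  intro c
  have h := hx (σ.symm c)
  simpa [Finset.mem_map_equiv] using h

set_option linter.unusedSectionVars false in
theorem IsHomog.update {S S' : Finset B} {x : B → Vec K E} (hx : IsHomog S x) (b : B)
    (hS : ∀ c, c ≠ b → (c ∈ S' ↔ c ∈ S)) {v : Vec K E}
    (hv : proj K E (decide (b ∈ S')) v = v) : IsHomog S' (Function.update x b v) := by
  intro c
  by_cases h : c = b
  · subst h
    simpa using hv
  · rw [Function.update_of_ne h]
    simpa [hS c h] using hx c

theorem tensorDer_tprod (T Y : Vec K E →ₗ[K] Vec K E) (ε : ℤ) {S : Finset B}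
    {x : B → Vec K E} (hx : IsHomog S x)
    (hT : ∀ (p : Bool) (v : Vec K E),
      T (proj K E p v) = ((if p then ε else 1 : ℤ) : K) • proj K E p v) :
    tensorDer T Y (PiTensorProduct.tprod K x) =
      ∑ b : B, ((∏ c ∈ S, if c < b then ε else 1 : ℤ) : K) •
        PiTensorProduct.tprod K (Function.update x b (Y (x b))) := by
  rw [tensorDer, LinearMap.sum_apply]
  refine Finset.sum_congr rfl fun b _ => ?_
  rw [PiTensorProduct.map_tprod]
  have key : (fun c => (if c < b then T else if c = b then Y else LinearMap.id) (x c)) =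
      fun c => (((if c ∈ S ∧ c < b then ε else 1 : ℤ) : K)) •
        Function.update x b (Y (x b)) c := by
    funext c
    rcases lt_trichotomy c b with h | h | h
    · rw [if_pos h, Function.update_of_ne h.ne]
      conv_lhs => rw [← hx c]
      rw [hT, hx c]
      by_cases hc : c ∈ S <;> simp [hc, h]
    · subst h
      simp
    · rw [if_neg h.not_gt, if_neg h.ne', Function.update_of_ne h.ne']
      simp [h.not_gt]
  rw [key, MultilinearMap.map_smul_univ]
  have hprod : (∏ c : B, (((if c ∈ S ∧ c < b then ε else 1 : ℤ) : K))) =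
      ((∏ c ∈ S, if c < b then ε else 1 : ℤ) : K) := by
    push_cast
    rw [← Finset.prod_subset (Finset.subset_univ S)]
    · refine Finset.prod_congr rfl fun c hc => ?_
      simp [hc]
    · intro c _ hc
      simp [hc]
  rw [hprod]

set_option linter.unusedSectionVars false in
theorem koszulSign_insert (σ : Equiv.Perm B) {S : Finset B} {b : B} (hb : b ∉ S) :
    koszulSign σ (insert b S) * (∏ c ∈ S, if c < b then (-1 : ℤ) else 1) =
      koszulSign σ S * (∏ c ∈ S, if σ c < σ b then (-1 : ℤ) else 1) := by
  have hk : koszulSign σ (insert b S) = koszulSign σ S *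
      ((∏ c ∈ S, if c < b ∧ σ b < σ c then (-1 : ℤ) else 1) *
        ∏ c ∈ S, if b < c ∧ σ c < σ b then (-1 : ℤ) else 1) := by
    simp only [koszulSign, Finset.prod_insert hb, lt_irrefl, false_and, if_false, one_mul,
      Finset.prod_mul_distrib]
    ring
  rw [hk, mul_assoc, ← Finset.prod_mul_distrib, ← Finset.prod_mul_distrib]
  congr 1
  refine Finset.prod_congr rfl fun c hc => ?_
  have hne : c ≠ b := fun h => hb (h ▸ hc)
  have hne' : σ c ≠ σ b := fun h => hne (σ.injective h)
  rcases lt_or_gt_of_ne hne with h | h <;> rcases lt_or_gt_of_ne hne' with h' | h' <;>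
    simp [h, h', h.not_gt, h'.not_gt]

theorem koszulSign_flip (σ : Equiv.Perm B) (S : Finset B) (b : B) :
    koszulSign σ (symmDiff S {b}) * (∏ c ∈ S, if c < b then (-1 : ℤ) else 1) =
      koszulSign σ S * (∏ c ∈ S, if σ c < σ b then (-1 : ℤ) else 1) := by
  have sq : ∀ (p : B → Prop) [DecidablePred p] (R : Finset B),
      (∏ c ∈ R, if p c then (-1 : ℤ) else 1) * (∏ c ∈ R, if p c then (-1 : ℤ) else 1) = 1 := by
    intro p _ R
    rw [← Finset.prod_mul_distrib]
    refine Finset.prod_eq_one fun c _ => ?_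
    split_ifs <;> simp
  by_cases hb : b ∈ S
  · have hS : symmDiff S {b} = S.erase b := by
      ext c
      by_cases h : c = b <;> simp [Finset.mem_symmDiff, h, hb]
    have hb' : b ∉ S.erase b := by simp
    have h1 := koszulSign_insert σ hb'
    rw [Finset.insert_erase hb] at h1
    rw [hS]
    have e1 : (∏ c ∈ S, if c < b then (-1 : ℤ) else 1) =
        ∏ c ∈ S.erase b, if c < b then (-1 : ℤ) else 1 := by
      rw [← Finset.mul_prod_erase S _ hb]; simp
    have e2 : (∏ c ∈ S, if σ c < σ b then (-1 : ℤ) else 1) =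
        ∏ c ∈ S.erase b, if σ c < σ b then (-1 : ℤ) else 1 := by
      rw [← Finset.mul_prod_erase S _ hb]; simp
    rw [e1, e2]
    have s1 := sq (fun c => c < b) (S.erase b)
    have s2 := sq (fun c => σ c < σ b) (S.erase b)
    generalize (∏ c ∈ S.erase b, if c < b then (-1 : ℤ) else 1) = u at *
    generalize (∏ c ∈ S.erase b, if σ c < σ b then (-1 : ℤ) else 1) = w at *
    calc koszulSign σ (S.erase b) * u = (koszulSign σ (S.erase b) * w) * w * u := by
          rw [mul_assoc (koszulSign σ (S.erase b)), s2, mul_one]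
      _ = koszulSign σ S * (u * u) * w := by rw [← h1]; ring
      _ = koszulSign σ S * w := by rw [s1, mul_one]
  · have hS : symmDiff S {b} = insert b S := by
      ext c
      by_cases h : c = b <;> simp [Finset.mem_symmDiff, h, hb]
    rw [hS]
    exact koszulSign_insert σ hb

theorem ext_homog {M : Type*} [AddCommMonoid M] [Module K M] {f g : TPow K E B →ₗ[K] M}
    (h : ∀ (S : Finset B) (x : B → Vec K E), IsHomog S x →
      f (PiTensorProduct.tprod K x) = g (PiTensorProduct.tprod K x)) : f = g := by
  apply PiTensorProduct.ext
  refine MultilinearMap.ext fun x => ?_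
  have hx : x = fun c => ∑ p : Bool, proj K E p (x c) := by
    funext c
    rw [sum_proj]
  simp only [LinearMap.compMultilinearMap_apply]
  rw [hx, MultilinearMap.map_sum (PiTensorProduct.tprod K (s := fun _ : B => Vec K E))
    (fun c p => proj K E p (x c)), map_sum, map_sum]
  refine Finset.sum_congr rfl fun r _ => h (Finset.univ.filter fun c => r c = true) _ fun c => ?_
  rw [proj_proj]
  simp

theorem tensorDer_comm (T Y : Vec K E →ₗ[K] Vec K E) (ε : ℤ) (flip : B → Finset B → Finset B)
    (hT : ∀ (p : Bool) (v : Vec K E),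
      T (proj K E p v) = ((if p then ε else 1 : ℤ) : K) • proj K E p v)
    (hflip : ∀ b S c, c ≠ b → (c ∈ flip b S ↔ c ∈ S))
    (hY : ∀ b S v, proj K E (decide (b ∈ flip b S)) (Y (proj K E (decide (b ∈ S)) v)) =
      Y (proj K E (decide (b ∈ S)) v))
    (σ : Equiv.Perm B)
    (hσ : ∀ b S, koszulSign σ (flip b S) * (∏ c ∈ S, if c < b then ε else 1) =
      koszulSign σ S * (∏ c ∈ S, if σ c < σ b then ε else 1)) :
    tensorDer T Y ∘ₗ signedPerm K E σ = signedPerm K E σ ∘ₗ tensorDer T Y := by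
  apply ext_homog
  intro S x hx
  rw [LinearMap.comp_apply, LinearMap.comp_apply, signedPerm_tprod σ hx, map_smul,
    tensorDer_tprod T Y ε (hx.perm σ) hT, tensorDer_tprod T Y ε hx hT, map_sum,
    Finset.smul_sum, ← Equiv.sum_comp σ]
  refine Finset.sum_congr rfl fun b _ => ?_
  have hu : IsHomog (flip b S) (Function.update x b (Y (x b))) :=
    hx.update b (hflip b S) (by have h := hY b S (x b); rwa [hx b] at h)
  rw [map_smul, signedPerm_tprod σ hu, smul_smul, smul_smul, ← Int.cast_mul, ← Int.cast_mul,
    mul_comm (∏ c ∈ S, _), hσ, Finset.prod_map]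
  congr 2
  funext c
  by_cases h : c = σ b
  · subst h
    simp
  · rw [Function.update_of_ne h, Function.update_of_ne]
    intro h'
    exact h (by rw [← h']; simp)

/-- The signed action of permutations on `V^{⊗ B}` commutes with the action of `gl(V)`. -/
theorem tensorAct_signedPerm (X : Vec K E →ₗ[K] Vec K E) (σ : Equiv.Perm B) :
    tensorAct X ∘ₗ signedPerm K E σ = signedPerm K E σ ∘ₗ tensorAct X := by
  rw [tensorAct, LinearMap.add_comp, LinearMap.comp_add]
  congr 1
  · refine tensorDer_comm _ _ 1 (fun _ S => S) ?_ ?_ ?_ σ ?_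
    · simp
    · simp
    · intro b S v
      exact evenPart_proj X _ v
    · simp
  · refine tensorDer_comm _ _ (-1) (fun b S => symmDiff S {b}) ?_ ?_ ?_ σ ?_
    · intro p v
      cases p
      · simp [parityInv, proj_proj]
      · simp [parityInv, proj_proj, neg_smul (1 : K) (proj K E true v)]
    · intro b S c h
      simp [Finset.mem_symmDiff, h]
    · intro b S v
      have h := oddPart_proj X (decide (b ∈ S)) v
      by_cases hb : b ∈ S <;> simpa [Finset.mem_symmDiff, hb] using h
    · exact fun b S => koszulSign_flip σ S b

end Tensor

/-! ## Schur complexes -/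

/-- The boxes of the skew diagram `lam / mu`. -/
@[ext] structure Box (lam mu : YoungDiagram) where
  /-- The row of the box, counted from `0`. -/
  row : ℕ
  /-- The column of the box, counted from `0`. -/
  col : ℕ
  mem : (row, col) ∈ lam.cells \ mu.cells

namespace Box

variable {lam mu : YoungDiagram}

noncomputable instance : Fintype (Box lam mu) :=
  Fintype.ofInjective
    (fun b => (⟨(b.row, b.col), b.mem⟩ : {c : ℕ × ℕ // c ∈ lam.cells \ mu.cells}))
    (by
      intro b c h
      have h1 : b.row = c.row ∧ b.col = c.col := by simpa using h
      exact Box.ext h1.1 h1.2)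

/-- The boxes are ordered column by column, from left to right, and from top to bottom within a
column. -/
noncomputable instance : LinearOrder (Box lam mu) :=
  LinearOrder.lift' (fun b : Box lam mu => toLex (b.col, b.row)) (by
    intro b c h
    have h1 : b.col = c.col ∧ b.row = c.row := by simpa using h
    exact Box.ext h1.2 h1.1)

/-- A box of `lam / mu` as a box of `lam`. -/
def incl (b : Box lam mu) : Box lam ⊥ :=
  ⟨b.row, b.col, Finset.mem_sdiff.2 ⟨(Finset.mem_sdiff.1 b.mem).1, by simp⟩⟩

theorem incl_injective : Function.Injective (incl : Box lam mu → Box lam ⊥) := by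
  intro b c h
  have h1 : b.row = c.row ∧ b.col = c.col := by simpa [incl] using h
  exact Box.ext h1.1 h1.2

end Box

section Schur

variable (K E : Type*) [Field K] [AddCommGroup E] [Module K E]
variable (lam mu : YoungDiagram)

/-- The antisymmetrization along the columns of `lam / mu`.  It factors as the projection of
`V^{⊗ lam/mu}` onto `⋀^{lam/mu} V`, the tensor product of the exterior powers of the superspace `V`
over the columns of `lam / mu`, followed by the comultiplication
`⋀^{lam/mu} V → V^{⊗ lam/mu}`, which is injective in characteristic zero. -/
noncomputable def colAlt : TPow K E (Box lam mu) →ₗ[K] TPow K E (Box lam mu) :=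
  ∑ σ : Equiv.Perm (Box lam mu) with ∀ b, (σ b).col = b.col,
    ((Equiv.Perm.sign σ : ℤ) : K) • signedPerm K E σ

/-- The symmetrization along the rows of `lam / mu`.  In characteristic zero its image (the tensors
that are symmetric along the rows) is `S^{lam/mu} V`, the tensor product of the symmetric powers of
the superspace `V` over the rows of `lam / mu`, and the map onto the image is the multiplication
`V^{⊗ lam/mu} → S^{lam/mu} V`. -/
noncomputable def rowSym : TPow K E (Box lam mu) →ₗ[K] TPow K E (Box lam mu) :=
  ∑ σ : Equiv.Perm (Box lam mu) with ∀ b, (σ b).row = b.row, signedPerm K E σ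

/-- The Schur map `⋀^{lam/mu} V → V^{⊗ lam/mu} → S^{lam/mu} V` (comultiplication along the columns
followed by multiplication along the rows), as a map on `V^{⊗ lam/mu}`. -/
noncomputable def schurMap : TPow K E (Box lam mu) →ₗ[K] TPow K E (Box lam mu) :=
  rowSym K E lam mu ∘ₗ colAlt K E lam mu

/-- The (skew) Schur complex `S_{lam/mu} V`, the image of the Schur map.
It is only meaningful for `mu ≤ lam`. -/
noncomputable def schur : Submodule K (TPow K E (Box lam mu)) :=
  LinearMap.range (schurMap K E lam mu)

/-- The projection onto `S_{lam/mu} V` (from `V^{⊗ lam/mu}`, through `⋀^{lam/mu} V`). -/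
noncomputable def schurProj : TPow K E (Box lam mu) →ₗ[K] schur K E lam mu :=
  (schurMap K E lam mu).rangeRestrict

/-- The component of `S_{lam/mu} V` of homological degree `d`. -/
noncomputable def schurPart (d : ℤ) : Submodule K (schur K E lam mu) :=
  (tensorPart K E (Box lam mu) d).comap (schur K E lam mu).subtype

/-- The component of `(S_{lam/mu} V)[1]` of homological degree `d`; the shift `[1]` is the one for
which `K[1]` is concentrated in homological degree `1`. -/
noncomputable def shiftPart (d : ℤ) : Submodule K (schur K E lam mu) :=
  schurPart K E lam mu (d - 1)

variable {K E}

theorem tensorAct_schurMap (X : Vec K E →ₗ[K] Vec K E) :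
    tensorAct X ∘ₗ schurMap K E lam mu = schurMap K E lam mu ∘ₗ tensorAct X := by
  have h0 (σ : Equiv.Perm (Box lam mu)) (x : TPow K E (Box lam mu)) :
      tensorAct X (signedPerm K E σ x) = signedPerm K E σ (tensorAct X x) :=
    LinearMap.congr_fun (tensorAct_signedPerm X σ) x
  refine LinearMap.ext fun x => ?_
  simp only [schurMap, rowSym, colAlt, LinearMap.comp_apply, LinearMap.sum_apply,
    LinearMap.smul_apply, map_sum, map_smul, h0]

theorem tensorAct_mem_schur (X : Vec K E →ₗ[K] Vec K E) :
    ∀ x ∈ schur K E lam mu, tensorAct X x ∈ schur K E lam mu := by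
  rintro _ ⟨y, rfl⟩
  exact ⟨tensorAct X y, (LinearMap.congr_fun (tensorAct_schurMap lam mu X) y).symm⟩

/-- The action of `X ∈ gl(V)` on `S_{lam/mu} V`. -/
noncomputable def schurAct (X : Vec K E →ₗ[K] Vec K E) :
    schur K E lam mu →ₗ[K] schur K E lam mu :=
  (tensorAct X).restrict (tensorAct_mem_schur lam mu X)

/-- The action of `X ∈ gl(V)` on `(S_{lam/mu} V)[1] = K[1] ⊗ S_{lam/mu} V`: a homogeneous `X` acts
as `(-1)^{|X|}` times its action on `S_{lam/mu} V`, since it moves past the odd line `K[1]`. -/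
noncomputable def shiftAct (X : Vec K E →ₗ[K] Vec K E) :
    schur K E lam mu →ₗ[K] schur K E lam mu :=
  schurAct lam mu (signTwist X)

end Schur

/-! ## Trace and evaluation -/

/-- The Young diagram of the partition `(1,1)`. -/
def oneOne : YoungDiagram := YoungDiagram.ofRowLens [1, 1] (by decide)

/-- The Young diagram of the partition `(2)`. -/
def two : YoungDiagram := YoungDiagram.ofRowLens [2] (by decide)

theorem mem_two {i j : ℕ} : (i, j) ∈ two ↔ i = 0 ∧ j < 2 := by
  rw [two, YoungDiagram.mem_ofRowLens]
  constructor
  · rintro ⟨h, h'⟩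
    have hi : i = 0 := by simpa using h
    subst hi
    exact ⟨rfl, by simpa using h'⟩
  · rintro ⟨rfl, h⟩
    exact ⟨by simp, by simpa using h⟩

section TraceEval

variable {K E : Type*} [Field K] [AddCommGroup E] [Module K E]
variable {lam : YoungDiagram}

/-- A vector on each box of `lam / mu`, completed to one on each box of `lam` by the vectors
`w i j` on the boxes `(i, j) ∈ mu`. -/
def fill (mu : YoungDiagram) (w : ℕ → ℕ → Vec K E) (x : Box lam mu → Vec K E) :
    Box lam ⊥ → Vec K E :=
  fun b => if h : (b.row, b.col) ∈ mu.cells then w b.row b.col else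
    x ⟨b.row, b.col, Finset.mem_sdiff.2 ⟨(Finset.mem_sdiff.1 b.mem).1, h⟩⟩

theorem fill_update (mu : YoungDiagram) (w : ℕ → ℕ → Vec K E) [DecidableEq (Box lam mu)]
    (x : Box lam mu → Vec K E) (b : Box lam mu) (v : Vec K E) :
    fill mu w (Function.update x b v) = Function.update (fill mu w x) b.incl v := by
  funext c
  by_cases hc : (c.row, c.col) ∈ mu.cells
  · have hne : c ≠ b.incl := by
      rintro rfl
      exact (Finset.mem_sdiff.1 b.mem).2 hc
    rw [Function.update_of_ne hne]
    simp only [fill, hc, dite_true]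
  · by_cases h : c = b.incl
    · subst h
      have hb : (b.row, b.col) ∉ mu.cells := (Finset.mem_sdiff.1 b.mem).2
      rw [Function.update_self]
      simp only [fill, hc, dite_false]
      exact Function.update_self b v x
    · rw [Function.update_of_ne h]
      simp only [fill, hc, dite_false]
      rw [Function.update_of_ne]
      rintro rfl
      exact h rfl

/-- The linear map `V^{⊗ lam/mu} → V^{⊗ lam}` that puts the vectors `w i j` on the boxes
`(i, j) ∈ mu`. -/
noncomputable def insertVec (mu : YoungDiagram) (w : ℕ → ℕ → Vec K E) :
    TPow K E (Box lam mu) →ₗ[K] TPow K E (Box lam ⊥) :=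
  PiTensorProduct.lift
    { toFun := fun x => PiTensorProduct.tprod K (fill mu w x)
      map_update_add' := by
        intro _ x b v v'
        rw [fill_update, fill_update, fill_update, MultilinearMap.map_update_add]
      map_update_smul' := by
        intro _ x b r v
        rw [fill_update, fill_update, MultilinearMap.map_update_smul] }

variable (K E lam) in
/-- The insertion of the trace element `∑ eᵢ ∧ eᵢ* ∈ ⋀² V` in the first column: the map
`V^{⊗ lam/(1,1)} → V^{⊗ lam}`, `x ↦ ∑ eᵢ ⊗ eᵢ* ⊗ x`, with `eᵢ` and `eᵢ*` on the first two boxes of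
the first column (which precede all other boxes), where `(eᵢ)` is a basis of `E` and `(eᵢ*)` the
dual basis.  On `⋀^{lam/(1,1)} V` it induces the trace `K[1] → ⋀² V` followed by the
multiplication into the first column. -/
noncomputable def insertTrace [FiniteDimensional K E] :
    TPow K E (Box lam oneOne) →ₗ[K] TPow K E (Box lam ⊥) :=
  ∑ i, insertVec oneOne (fun r _ =>
    if r = 0 then (Module.finBasis K E i, 0) else (0, (Module.finBasis K E).coord i))

/-- The evaluation pairing on `V = E ⊕ E*`; on the symmetric square of the superspace `V` it is
the evaluation map `S² V → K[1]`. -/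
def evalPairing (v w : Vec K E) : K := w.2 v.1 + v.2 w.1

/-- The box `(0, j)` of `lam`, for `j < 2` and `(2) ⊆ lam`. -/
def firstRowBox (h : two ≤ lam) (j : Fin 2) : Box lam ⊥ :=
  ⟨0, j, Finset.mem_sdiff.2 ⟨YoungDiagram.cells_subset_iff.2 h
    ((YoungDiagram.mem_cells _).2 (mem_two.2 ⟨rfl, j.2⟩)), by simp⟩⟩

theorem firstRowBox_ne (h : two ≤ lam) : firstRowBox h 0 ≠ firstRowBox h 1 := by
  simp [firstRowBox]

theorem eq_firstRowBox_or (h : two ≤ lam) (b : Box lam ⊥) :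
    b = firstRowBox h 0 ∨ b = firstRowBox h 1 ∨ ∃ c : Box lam two, b = c.incl := by
  obtain ⟨i, j, hb⟩ := b
  by_cases hm : (i, j) ∈ two
  · obtain ⟨rfl, hj⟩ := mem_two.1 hm
    interval_cases j
    · exact Or.inl rfl
    · exact Or.inr (Or.inl rfl)
  · exact Or.inr (Or.inr ⟨⟨i, j, Finset.mem_sdiff.2 ⟨(Finset.mem_sdiff.1 hb).1, hm⟩⟩, rfl⟩)

theorem incl_ne_firstRowBox (h : two ≤ lam) (c : Box lam two) (j : Fin 2) :
    firstRowBox h j ≠ c.incl := by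
  intro hc
  have h1 : 0 = c.row ∧ (j : ℕ) = c.col := by simpa [firstRowBox, Box.incl] using hc
  refine (Finset.mem_sdiff.1 c.mem).2 ((YoungDiagram.mem_cells _).2 (mem_two.2 ⟨h1.1.symm, ?_⟩))
  rw [← h1.2]
  exact j.2

/-- The linear map `V^{⊗ lam} → V^{⊗ lam/(2)}` that contracts the factors on the first two boxes of
the first row by the evaluation pairing, without signs. -/
noncomputable def contract (h : two ≤ lam) :
    TPow K E (Box lam ⊥) →ₗ[K] TPow K E (Box lam two) :=
  PiTensorProduct.lift
    { toFun := fun x => evalPairing (x (firstRowBox h 0)) (x (firstRowBox h 1)) •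
        PiTensorProduct.tprod K (fun b : Box lam two => x b.incl)
      map_update_add' := by
        intro _ x b v v'
        rcases eq_firstRowBox_or h b with rfl | rfl | ⟨c, rfl⟩
        · simp only [Function.update_self, Function.update_of_ne (firstRowBox_ne h).symm,
            Function.update_of_ne (incl_ne_firstRowBox h _ 0).symm, ← add_smul]
          congr 1
          simp [evalPairing]; ring
        · simp only [Function.update_self, Function.update_of_ne (firstRowBox_ne h),
            Function.update_of_ne (incl_ne_firstRowBox h _ 1).symm, ← add_smul]
          congr 1
          simp [evalPairing]; ring
        · have hu (u : Vec K E) : (fun b : Box lam two => Function.update x c.incl u b.incl) =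
              Function.update (fun b : Box lam two => x b.incl) c u :=
            Function.update_comp_eq_of_injective x Box.incl_injective c u
          simp only [Function.update_of_ne (incl_ne_firstRowBox h c _), hu,
            MultilinearMap.map_update_add, smul_add]
      map_update_smul' := by
        intro _ x b r v
        rcases eq_firstRowBox_or h b with rfl | rfl | ⟨c, rfl⟩
        · simp only [Function.update_self, Function.update_of_ne (firstRowBox_ne h).symm,
            Function.update_of_ne (incl_ne_firstRowBox h _ 0).symm, smul_smul]
          congr 1
          simp [evalPairing]; ring
        · simp only [Function.update_self, Function.update_of_ne (firstRowBox_ne h),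
            Function.update_of_ne (incl_ne_firstRowBox h _ 1).symm, smul_smul]
          congr 1
          simp [evalPairing]; ring
        · have hu (u : Vec K E) : (fun b : Box lam two => Function.update x c.incl u b.incl) =
              Function.update (fun b : Box lam two => x b.incl) c u :=
            Function.update_comp_eq_of_injective x Box.incl_injective c u
          simp only [Function.update_of_ne (incl_ne_firstRowBox h c _), hu,
            MultilinearMap.map_update_smul, smul_comm r] }

variable (K E) in
/-- The evaluation in the first row, `V^{⊗ lam} → V^{⊗ lam/(2)}`: the contraction of the factors on
the boxes `(0, 0)` and `(0, 1)` by the evaluation pairing, with the Koszul sign of moving the second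
of these factors next to the first one (which precedes all other boxes).  On the tensors that are
symmetric along the rows, i.e. on `S^{lam} V`, it is, up to a nonzero scalar, the comultiplication
of the first row followed by the evaluation `S² V → K[1]`. -/
noncomputable def evalRow (h : two ≤ lam) :
    TPow K E (Box lam ⊥) →ₗ[K] TPow K E (Box lam two) :=
  ∑ S : Finset (Box lam ⊥),
    (if firstRowBox h 1 ∈ S then
      (-1 : K) ^ (S.filter fun b => firstRowBox h 0 < b ∧ b < firstRowBox h 1).card else 1) •
    (contract h ∘ₗ tensorProj K E S)

end TraceEval

end Periplectic

namespace Periplectic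

/-! The Schur map of `lam` is a product `R * C` of the row symmetrizer and the column
antisymmetrizer, acting on `V^{⊗ lam}` by signed permutations. For a set `F` of frozen boxes let
`R_F` and `C_F` be the sums over the row and column permutations that fix `F` pointwise. When `F` is
the diagram `mu`, `R_F * C_F` is the Schur map of `lam / mu` acting on the remaining factors.

Descent rests on one identity in the group algebra, `exists_stabSum_mul_stabSum`: freezing one more
box `x`, topmost among the unfrozen boxes of its column, gives `R_F * C_F = u * (R_{F∪x} * C_{F∪x})`
for some `u`. Two applications freeze `(1,1)`. Inserting the trace commutes with permutations of the
boxes of `lam/(1,1)`, so the Schur map after insertion factors through the Schur map of `lam/(1,1)`.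
The mirror identity, with `u` on the right, freezes `(2)` and shows that evaluation sends the image
of one Schur map into the image of the other.

Equivariance is a computation with Koszul signs. The odd trace, respectively evaluation, produces
the sign `(-1)^{|X|}` of the shift. The evaluation pairing is invariant already on `V ⊗ V`, so
`evalRow_tensorAct` holds on all tensors. The tensor `∑ eᵢ ⊗ eᵢ*` is invariant only modulo
supersymmetric tensors, which the column antisymmetrizer kills; this is
`schurMap_tensorAct_insertTrace`.

For nonvanishing, one coordinate of the image of an explicit basis tensor is computed. Its label
function increases by one down each column, and `eq_one_of_comp_eq` shows that then a single column
permutation contributes. Row permutations carry no sign in degree at most one, so the contributions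
add up to a nonzero integer (`insertTrace_nonzero`, `evalRow_nonzero`). -/

theorem eq_zero_of_eq_neg_smul {K M : Type*} [Field K] [CharZero K] [AddCommMonoid M]
    [Module K M] {y : M} (h : y = (-1 : K) • y) : y = 0 := by
  have h2 : (2 : K) • y = 0 := by
    rw [two_smul]
    nth_rewrite 2 [h]
    nth_rewrite 1 [← one_smul K y]
    rw [← add_smul, add_neg_cancel, zero_smul]
  have h3 := congrArg (fun z => (2 : K)⁻¹ • z) h2
  simpa [smul_smul] using h3

set_option linter.unusedSectionVars false

/-! ### Row and column symmetrizers with frozen boxes. -/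

section Stabilizers

open Equiv

variable {B : Type*} [Fintype B] [DecidableEq B]

/-- The permutations that preserve the function `r` and fix the elements of `F`. -/
def stabilizer (r : B → ℕ) (F : Finset B) : Subgroup (Perm B) where
  carrier := {σ | (∀ b, r (σ b) = r b) ∧ ∀ b ∈ F, σ b = b}
  mul_mem' := by
    rintro σ τ ⟨h1, h2⟩ ⟨k1, k2⟩
    exact ⟨fun b => by simp [h1, k1], fun b hb => by simp [k2 b hb, h2 b hb]⟩
  one_mem' := by simp
  inv_mem' := by
    rintro σ ⟨h1, h2⟩
    refine ⟨fun b => ?_, fun b hb => ?_⟩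
    · rw [← h1 (σ⁻¹ b)]; simp
    · rw [Perm.inv_eq_iff_eq, h2 b hb]

theorem mem_stabilizer {r : B → ℕ} {F : Finset B} {σ : Perm B} :
    σ ∈ stabilizer r F ↔ (∀ b, r (σ b) = r b) ∧ ∀ b ∈ F, σ b = b := Iff.rfl

instance (r : B → ℕ) (F : Finset B) : DecidablePred (· ∈ stabilizer r F) :=
  fun _ => decidable_of_iff _ mem_stabilizer.symm

theorem swap_mem_stabilizer {r : B → ℕ} {F : Finset B} {b c : B} (h : r b = r c)
    (hb : b ∉ F) (hc : c ∉ F) : swap b c ∈ stabilizer r F := by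
  refine ⟨fun x => ?_, fun x hx => swap_apply_of_ne_of_ne ?_ ?_⟩
  · rcases eq_or_ne x b with rfl | h1
    · simp [h]
    · rcases eq_or_ne x c with rfl | h2
      · simp [h]
      · rw [swap_apply_of_ne_of_ne h1 h2]
  · rintro rfl; exact hb hx
  · rintro rfl; exact hc hx

theorem stabilizer_insert_le (r : B → ℕ) (F : Finset B) (x : B) :
    stabilizer r (insert x F) ≤ stabilizer r F :=
  fun _ h => ⟨h.1, fun b hb => h.2 b (Finset.mem_insert_of_mem hb)⟩

variable {K A : Type*} [Field K] [Semiring A] [Algebra K A] (ρ : Perm B →* A)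

variable (K) in
/-- The sum of the elements of `stabilizer r F`, weighted by the character `ε`. -/
def stabSum (ε : Perm B →* ℤˣ) (r : B → ℕ) (F : Finset B) : A :=
  ∑ σ with σ ∈ stabilizer r F, ((ε σ : ℤ) : K) • ρ σ

variable {ρ} {ε : Perm B →* ℤˣ} {r : B → ℕ} {F : Finset B}

theorem units_mul_self_cast (u : ℤˣ) : ((u : ℤ) : K) * ((u : ℤ) : K) = 1 := by
  rw [← Int.cast_mul, ← Units.val_mul, Int.units_mul_self]; simp

theorem mul_stabSum {τ : Perm B} (hτ : τ ∈ stabilizer r F) :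
    ρ τ * stabSum K ρ ε r F = ((ε τ : ℤ) : K) • stabSum K ρ ε r F := by
  rw [stabSum, Finset.mul_sum, Finset.smul_sum]
  refine Finset.sum_equiv (Equiv.mulLeft τ) (fun σ => ?_) fun σ _ => ?_
  · simp [Subgroup.mul_mem_cancel_left _ hτ]
  · simp only [Equiv.coe_mulLeft, map_mul, Units.val_mul, Int.cast_mul, smul_smul, mul_smul_comm]
    rw [← mul_assoc, units_mul_self_cast, one_mul]

theorem stabSum_mul {τ : Perm B} (hτ : τ ∈ stabilizer r F) :
    stabSum K ρ ε r F * ρ τ = ((ε τ : ℤ) : K) • stabSum K ρ ε r F := by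
  rw [stabSum, Finset.sum_mul, Finset.smul_sum]
  refine Finset.sum_equiv (Equiv.mulRight τ) (fun σ => ?_) fun σ _ => ?_
  · simp [Subgroup.mul_mem_cancel_right _ hτ]
  · simp only [Equiv.coe_mulRight, map_mul, Units.val_mul, Int.cast_mul, smul_smul, smul_mul_assoc]
    rw [mul_comm ((ε σ : ℤ) : K), ← mul_assoc, units_mul_self_cast, one_mul]

theorem stabSum_mul_stabSum {F' : Finset B} (h : stabilizer r F' ≤ stabilizer r F) :
    stabSum K ρ ε r F * stabSum K ρ ε r F' =
      (((Finset.univ.filter (· ∈ stabilizer r F')).card : ℕ) : K) • stabSum K ρ ε r F := by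
  conv_lhs => rw [stabSum.eq_def _ _ _ _ F', Finset.mul_sum]
  rw [Finset.sum_congr rfl (g := fun _ => stabSum K ρ ε r F), Finset.sum_const, Nat.cast_smul_eq_nsmul]
  intro σ hσ
  rw [mul_smul_comm, stabSum_mul (h (Finset.mem_filter.1 hσ).2), smul_smul, units_mul_self_cast,
    one_smul]

/-- Coset decomposition modulo the stabilizer of `x`: a permutation is sorted by its value `c` at
`x`, and `swap x c` represents the coset. -/
theorem stabSum_eq_sum_swap {x : B} (hx : x ∉ F) :
    stabSum K ρ ε r F = ∑ c with r c = r x ∧ c ∉ F,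
      (((ε (swap x c) : ℤ) : K)) • (ρ (swap x c) * stabSum K ρ ε r (insert x F)) := by
  have hmaps : ∀ σ ∈ Finset.univ.filter (· ∈ stabilizer r F),
      σ x ∈ Finset.univ.filter fun c => r c = r x ∧ c ∉ F := by
    intro σ hσ
    have hσ' := (Finset.mem_filter.1 hσ).2
    refine Finset.mem_filter.2 ⟨Finset.mem_univ _, hσ'.1 x, fun h => hx ?_⟩
    have := hσ'.2 _ h
    rwa [σ.injective this] at h
  rw [stabSum, ← Finset.sum_fiberwise_of_maps_to hmaps]
  refine Finset.sum_congr rfl fun c hc => ?_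
  obtain ⟨-, hc1, hc2⟩ := Finset.mem_filter.1 hc
  have hs : swap x c ∈ stabilizer r F := swap_mem_stabilizer hc1.symm hx hc2
  rw [stabSum, Finset.mul_sum, Finset.smul_sum]
  refine Finset.sum_equiv (Equiv.mulLeft (swap x c)) (fun σ => ?_) fun σ _ => ?_
  · simp only [Finset.mem_filter, Finset.mem_univ, true_and, Equiv.coe_mulLeft]
    constructor
    · rintro ⟨h1, h2⟩
      have h3 := mul_mem hs h1
      refine ⟨h3.1, fun b hb => ?_⟩
      rcases Finset.mem_insert.1 hb with rfl | hb
      · simp [h2]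
      · exact h3.2 b hb
    · intro h
      refine ⟨(Subgroup.mul_mem_cancel_left _ hs).1 (stabilizer_insert_le _ _ _ h), ?_⟩
      have := h.2 x (Finset.mem_insert_self _ _)
      rw [Perm.mul_apply, swap_apply_eq_iff] at this
      simpa using this
  · simp only [Equiv.coe_mulLeft, mul_smul_comm, smul_smul, ← map_mul, ← Units.val_mul,
      ← Int.cast_mul, ← mul_assoc, swap_mul_self, one_mul]

/-- The polarization argument: the product of a row symmetrizer and a column symmetrizer of opposite
sign factors through the product for the diagram with the box `x` removed. -/
theorem exists_stabSum_mul_stabSum [CharZero K] {ε₁ ε₂ : Perm B →* ℤˣ}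
    (hε : ∀ b c, b ≠ c → ε₁ (swap b c) * ε₂ (swap b c) = -1) {row col : B → ℕ} {x : B} (hx : x ∉ F)
    (hd : ∀ c, col c = col x → c ∉ F → c ≠ x → ∀ b, row b = row c → b ∉ F → b ≠ c →
      ∃ d, d ∉ F ∧ row d = row x ∧ col d = col b ∧ col d ≠ col x ∧ d ≠ b) :
    ∃ u : A, stabSum K ρ ε₁ row F * stabSum K ρ ε₂ col F =
      u * (stabSum K ρ ε₁ row (insert x F) * stabSum K ρ ε₂ col (insert x F)) := by
  set R := stabSum K ρ ε₁ row F with hR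
  set R' := stabSum K ρ ε₁ row (insert x F) with hR'
  set C' := stabSum K ρ ε₂ col (insert x F) with hC'
  set N : K := (((Finset.univ.filter (· ∈ stabilizer row (insert x F))).card : ℕ) : K)
  have hN : N ≠ 0 := by
    refine Nat.cast_ne_zero.2 (Finset.card_ne_zero.2 ⟨1, ?_⟩)
    simp [one_mem]
  have hRR : R * R' = N • R := stabSum_mul_stabSum (stabilizer_insert_le _ _ _)
  -- By the coset decomposition of the column sum, it suffices to treat each coset representative
  -- separately.
  have key : ∀ c, col c = col x → c ∉ F → ∃ u, R * ρ (swap x c) * C' = u * (R' * C') := by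
    intro c hc hcF
    rcases eq_or_ne c x with rfl | hcx
    · refine ⟨N⁻¹ • R, ?_⟩
      rw [← mul_assoc, smul_mul_assoc, hRR, smul_smul, inv_mul_cancel₀ hN, one_smul]
      simp [← Perm.one_def]
    -- A Jucys–Murphy-like sum over the whole row of `c`. Conjugation by a row permutation fixing
    -- `x` permutes its terms, so it commutes with `R'`, which a single transposition need not do.
    set J : A := ∑ b with row b = row c ∧ b ∉ insert x F, ρ (swap x b) with hJ
    have hJR : J * R' = R' * J := by
      rw [hR', stabSum, Finset.mul_sum, Finset.sum_mul]
      refine Finset.sum_congr rfl fun p hp => ?_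
      have hp := (Finset.mem_filter.1 hp).2
      rw [mul_smul_comm, smul_mul_assoc]
      congr 1
      rw [hJ, Finset.sum_mul, Finset.mul_sum]
      symm
      refine Finset.sum_equiv p (fun b => ?_) fun b _ => ?_
      · simp only [Finset.mem_filter, Finset.mem_univ, true_and, hp.1 b]
        refine and_congr_right fun _ => not_congr ⟨fun h => ?_, fun h => ?_⟩
        · rwa [hp.2 b h]
        · have := hp.2 _ h
          rwa [p.injective this] at h
      · rw [← map_mul, ← map_mul]
        congr 1
        have hpx : p x = x := hp.2 x (Finset.mem_insert_self _ _)
        conv_rhs => rw [← hpx]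
        rw [swap_apply_apply]
        simp
    -- Every term with `b ≠ c` vanishes. Let `d` be the box in the row of `x` and the column of `b`.
    -- Moving `swap d b` out of `C'` through `swap x b` turns it into `swap d x`, which `R` absorbs.
    -- The two characters take opposite values on transpositions, so the term equals its own
    -- negative.
    have hJC : R * J * C' = R * ρ (swap x c) * C' := by
      rw [hJ, Finset.mul_sum, Finset.sum_mul, Finset.sum_eq_single c]
      · intro b hb hbc
        obtain ⟨-, hb1, hb2⟩ := Finset.mem_filter.1 hb
        have hbF : b ∉ F := fun h => hb2 (Finset.mem_insert_of_mem h)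
        have hbx : b ≠ x := fun h => hb2 (h ▸ Finset.mem_insert_self _ _)
        obtain ⟨d, hdF, hd1, hd2, hd3, hdb⟩ := hd c hc hcF hcx b hb1 hbF hbc
        have hdx : d ≠ x := fun h => hd3 (h ▸ rfl)
        have hs : swap d b ∈ stabilizer col (insert x F) := by
          refine swap_mem_stabilizer hd2 ?_ hb2
          simp [hdF, hdx]
        have hp : swap d x ∈ stabilizer row F := swap_mem_stabilizer hd1 hdF hx
        have e1 : swap x b * swap d b = swap d x * swap x b := by
          have h := swap_apply_apply (swap x b) d b
          rw [swap_apply_right, swap_apply_of_ne_of_ne hdx hdb] at h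
          rw [h, inv_mul_cancel_right]
        have h1 := mul_stabSum (K := K) (ρ := ρ) (ε := ε₂) hs
        have h2 := stabSum_mul (K := K) (ρ := ρ) (ε := ε₁) hp
        rw [← hC'] at h1
        rw [← hR] at h2
        have h3 : R * ρ (swap x b) * (ρ (swap d b) * C') = R * ρ (swap d x) * ρ (swap x b) * C' := by
          have := congrArg (fun g => R * ρ g * C') e1
          simpa [mul_assoc] using this
        rw [h1, h2] at h3
        simp only [mul_smul_comm, smul_mul_assoc] at h3
        -- Transpositions are conjugate, and a character with commutative values is constant on
        -- conjugacy classes.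
        have hsw : ε₁ (swap d x) = ε₁ (swap d b) := by
          obtain ⟨g, hg⟩ := isConj_iff.1 (Perm.isConj_swap hdx hdb)
          rw [← hg, map_mul, map_mul, mul_comm (ε₁ g), mul_assoc, ← map_mul]
          simp
        have h4 := hε d b hdb
        rw [hsw] at h3
        rcases Int.units_eq_one_or (ε₁ (swap d b)) with h5 | h5 <;>
        rcases Int.units_eq_one_or (ε₂ (swap d b)) with h6 | h6
        · simp [h5, h6] at h4
        · simp only [h5, h6, Units.val_neg, Units.val_one, Int.cast_neg, Int.cast_one,
            one_smul] at h3
          exact eq_zero_of_eq_neg_smul h3.symm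
        · simp only [h5, h6, Units.val_neg, Units.val_one, Int.cast_neg, Int.cast_one,
            one_smul] at h3
          exact eq_zero_of_eq_neg_smul h3
        · simp [h5, h6] at h4
      · intro h
        simp [hcF, hcx] at h
    -- Since `R = N⁻¹ • (R * R')`, a factor `R'` can be created and moved past `J` until it meets
    -- `C'`.
    refine ⟨N⁻¹ • (R * J), ?_⟩
    rw [← hJC, smul_mul_assoc, ← mul_assoc (R * J), mul_assoc R J R', hJR, ← mul_assoc, hRR]
    simp only [smul_mul_assoc, smul_smul, inv_mul_cancel₀ hN, one_smul]
  choose! u hu using key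
  refine ⟨∑ c with col c = col x ∧ c ∉ F, ((ε₂ (swap x c) : ℤ) : K) • u c, ?_⟩
  rw [stabSum_eq_sum_swap (K := K) (ρ := ρ) (ε := ε₂) hx, Finset.mul_sum, Finset.sum_mul]
  refine Finset.sum_congr rfl fun c hc => ?_
  obtain ⟨-, hc1, hc2⟩ := Finset.mem_filter.1 hc
  rw [mul_smul_comm, ← mul_assoc, hu c hc1 hc2, smul_mul_assoc]

/-- The inverse of a group representation, with values in the opposite algebra. -/
def opRep (ρ : Perm B →* A) : Perm B →* Aᵐᵒᵖ where
  toFun σ := MulOpposite.op (ρ σ⁻¹)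
  map_one' := by simp
  map_mul' σ τ := by simp

theorem stabSum_opRep : stabSum K (opRep ρ) ε r F = MulOpposite.op (stabSum K ρ ε r F) := by
  rw [stabSum, stabSum, Finset.op_sum]
  refine Finset.sum_equiv (Equiv.inv _) (fun σ => by simp) fun σ _ => ?_
  simp [opRep]

/-- The opposite algebra reverses the product, and composing with inversion keeps a representation
whose symmetrizers are the original ones. The left-hand version, with rows and columns exchanged,
therefore gives this one. -/
theorem exists_stabSum_mul_stabSum_right [CharZero K] {ε₁ ε₂ : Perm B →* ℤˣ}
    (hε : ∀ b c, b ≠ c → ε₁ (swap b c) * ε₂ (swap b c) = -1) {row col : B → ℕ} {x : B} (hx : x ∉ F)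
    (hd : ∀ c, row c = row x → c ∉ F → c ≠ x → ∀ b, col b = col c → b ∉ F → b ≠ c →
      ∃ d, d ∉ F ∧ col d = col x ∧ row d = row b ∧ row d ≠ row x ∧ d ≠ b) :
    ∃ u : A, stabSum K ρ ε₁ row F * stabSum K ρ ε₂ col F =
      stabSum K ρ ε₁ row (insert x F) * stabSum K ρ ε₂ col (insert x F) * u := by
  obtain ⟨u, hu⟩ := exists_stabSum_mul_stabSum (K := K) (ρ := opRep ρ) (ε₁ := ε₂) (ε₂ := ε₁)
    (fun b c h => by rw [mul_comm]; exact hε b c h) hx hd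
  refine ⟨u.unop, ?_⟩
  simp only [stabSum_opRep] at hu
  exact MulOpposite.op_injective hu

end Stabilizers

/-! ### Signed permutations as a representation, homological degree, and the action on homogeneous
tensors. -/

section SignedPerm

variable {K E : Type*} [Field K] [AddCommGroup E] [Module K E]
variable {B : Type*} [Fintype B] [LinearOrder B]

theorem prod_sign_mul_self {p : B → Prop} [DecidablePred p] (S : Finset B) :
    (∏ c ∈ S, if p c then (-1 : ℤ) else 1) * (∏ c ∈ S, if p c then (-1 : ℤ) else 1) = 1 := by
  rw [← Finset.prod_mul_distrib]
  refine Finset.prod_eq_one fun c _ => ?_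
  split_ifs <;> simp

/-- The cocycle identity that makes the signed action multiplicative. Odd positions are added one at
a time; `koszulSign_insert` compares the order signs before and after each permutation, and these
signs cancel because they square to one. -/
theorem koszulSign_mul (σ τ : Equiv.Perm B) (S : Finset B) :
    koszulSign (σ * τ) S = koszulSign σ (S.map τ.toEmbedding) * koszulSign τ S := by
  induction S using Finset.induction_on with
  | empty => simp [koszulSign]
  | insert b S hb ih =>
    have h1 : koszulSign (σ * τ) (insert b S) * (∏ c ∈ S, if c < b then (-1 : ℤ) else 1) =
        koszulSign (σ * τ) S * (∏ c ∈ S, if σ (τ c) < σ (τ b) then (-1 : ℤ) else 1) :=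
      koszulSign_insert (σ * τ) hb
    have h2 := koszulSign_insert τ hb
    have hb' : τ b ∉ S.map τ.toEmbedding := by simpa using hb
    have h3 := koszulSign_insert σ hb'
    rw [Finset.prod_map, Finset.prod_map] at h3
    rw [Finset.map_insert]
    simp only [Equiv.coe_toEmbedding] at h3 ⊢
    have s1 := prod_sign_mul_self (p := fun c => c < b) S
    have s2 := prod_sign_mul_self (p := fun c => τ c < τ b) S
    generalize (∏ c ∈ S, if c < b then (-1 : ℤ) else 1) = u at *
    generalize (∏ c ∈ S, if τ c < τ b then (-1 : ℤ) else 1) = v at *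
    generalize (∏ c ∈ S, if σ (τ c) < σ (τ b) then (-1 : ℤ) else 1) = w at *
    generalize koszulSign σ (insert (τ b) (Finset.map τ.toEmbedding S)) = k at *
    generalize koszulSign τ (insert b S) = l at *
    calc koszulSign (σ * τ) (insert b S)
        = koszulSign (σ * τ) (insert b S) * u * u := by rw [mul_assoc, s1, mul_one]
      _ = koszulSign σ (S.map τ.toEmbedding) * w * (koszulSign τ S * v) * v * u := by
          rw [h1, ih]; linear_combination (-koszulSign σ (S.map τ.toEmbedding) * koszulSign τ S * w * u) * s2
      _ = k * l * (u * u) * (v * v) := by rw [← h3, ← h2]; ring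
      _ = k * l := by rw [s1, s2, mul_one, mul_one]

theorem koszulSign_of_card_le_one (σ : Equiv.Perm B) {S : Finset B} (hS : S.card ≤ 1) :
    koszulSign σ S = 1 := by
  refine Finset.prod_eq_one fun i hi => Finset.prod_eq_one fun j hj => ?_
  rw [Finset.card_le_one.1 hS i hi j hj]
  simp

theorem koszulSign_one (S : Finset B) : koszulSign (1 : Equiv.Perm B) S = 1 := by
  refine Finset.prod_eq_one fun i hi => Finset.prod_eq_one fun j hj => ?_
  rw [if_neg]
  exact fun h => h.1.not_gt h.2

variable (K E B) in
/-- The action of permutations on `V^{⊗ B}`, with the Koszul sign rule, as a representation. -/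
noncomputable def signedPermHom : Equiv.Perm B →* Module.End K (TPow K E B) where
  toFun σ := signedPerm K E σ
  map_one' := ext_homog fun S x hx => by
    rw [signedPerm_tprod 1 hx, koszulSign_one]
    simp [← Equiv.Perm.inv_def]
  map_mul' σ τ := ext_homog fun S x hx => by
    rw [signedPerm_tprod _ hx, Module.End.mul_apply, signedPerm_tprod _ hx, map_smul,
      signedPerm_tprod _ (hx.perm τ), smul_smul, koszulSign_mul, Int.cast_mul,
      mul_comm (koszulSign τ S : K)]
    rfl

@[simp] theorem signedPermHom_apply (σ : Equiv.Perm B) :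
    signedPermHom K E B σ = signedPerm K E σ := rfl

variable (K E B) in
/-- The projection of `V^{⊗ B}` onto its part of homological degree `d`. -/
noncomputable def degProj (d : ℤ) : TPow K E B →ₗ[K] TPow K E B :=
  ∑ S : Finset B with (S.card : ℤ) = d, tensorProj K E S

theorem degProj_tprod {S : Finset B} {x : B → Vec K E} (hx : IsHomog S x) (d : ℤ) :
    degProj K E B d (PiTensorProduct.tprod K x) =
      if (S.card : ℤ) = d then PiTensorProduct.tprod K x else 0 := by
  rw [degProj, LinearMap.sum_apply]
  simp only [tensorProj_tprod hx, Finset.sum_ite_eq', Finset.mem_filter, Finset.mem_univ, true_and]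

theorem degProj_degProj (d : ℤ) (x : TPow K E B) :
    degProj K E B d (degProj K E B d x) = degProj K E B d x := by
  refine LinearMap.congr_fun (f := degProj K E B d ∘ₗ degProj K E B d) (ext_homog ?_) x
  intro S x hx
  rw [LinearMap.comp_apply, degProj_tprod hx]
  split_ifs with h
  · rw [degProj_tprod hx, if_pos h]
  · simp

theorem mem_tensorPart {d : ℤ} {x : TPow K E B} :
    x ∈ tensorPart K E B d ↔ degProj K E B d x = x := by
  constructor
  · rintro ⟨y, rfl⟩
    exact degProj_degProj d y
  · intro h
    exact ⟨x, h⟩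

theorem tprod_mem_tensorPart {S : Finset B} {x : B → Vec K E} (hx : IsHomog S x) :
    PiTensorProduct.tprod K x ∈ tensorPart K E B (S.card : ℤ) := by
  rw [mem_tensorPart, degProj_tprod hx, if_pos rfl]

theorem degProj_signedPerm (d : ℤ) (σ : Equiv.Perm B) (x : TPow K E B) :
    degProj K E B d (signedPerm K E σ x) = signedPerm K E σ (degProj K E B d x) := by
  refine LinearMap.congr_fun (f := degProj K E B d ∘ₗ signedPerm K E σ)
    (g := signedPerm K E σ ∘ₗ degProj K E B d) (ext_homog ?_) x
  intro S x hx
  simp only [LinearMap.comp_apply, signedPerm_tprod σ hx, degProj_tprod hx, map_smul,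
    degProj_tprod (hx.perm σ), Finset.card_map]
  split_ifs
  · rw [signedPerm_tprod σ hx]
  · simp

/-- A linear map from or to a tensor power that shifts the homological degree. -/
theorem degProj_comp {B' : Type*} [Fintype B'] [LinearOrder B']
    {f : TPow K E B →ₗ[K] TPow K E B'} {d d' : ℤ}
    (h : ∀ (S : Finset B) (x : B → Vec K E), IsHomog S x →
      degProj K E B' d' (f (PiTensorProduct.tprod K x)) =
        if (S.card : ℤ) = d then f (PiTensorProduct.tprod K x) else 0) (x : TPow K E B) :
    degProj K E B' d' (f x) = f (degProj K E B d x) := by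
  refine LinearMap.congr_fun (f := degProj K E B' d' ∘ₗ f) (g := f ∘ₗ degProj K E B d)
    (ext_homog ?_) x
  intro S x hx
  rw [LinearMap.comp_apply, LinearMap.comp_apply, h S x hx, degProj_tprod hx]
  split_ifs <;> simp

theorem tensorDer_neg (T Y : Vec K E →ₗ[K] Vec K E) :
    tensorDer (B := B) T (-Y) = (-1 : K) • tensorDer T Y := by
  apply ext_homog
  intro S x _
  rw [LinearMap.smul_apply, tensorDer, tensorDer, LinearMap.sum_apply, LinearMap.sum_apply,
    Finset.smul_sum]
  refine Finset.sum_congr rfl fun b _ => ?_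
  rw [PiTensorProduct.map_tprod, PiTensorProduct.map_tprod]
  have h (Z : Vec K E →ₗ[K] Vec K E) :
      (fun c => (if c < b then T else if c = b then Z else LinearMap.id) (x c)) =
        Function.update (fun c => (if c < b then T else LinearMap.id) (x c)) b (Z (x b)) := by
    funext c
    by_cases hc : c = b
    · subst hc; simp
    · simp [hc]
  rw [h, h, LinearMap.neg_apply, ← neg_one_smul K, MultilinearMap.map_update_smul]

theorem evenPart_signTwist (X : Vec K E →ₗ[K] Vec K E) : evenPart (signTwist X) = evenPart X := by
  ext v <;> simp [signTwist, evenPart, oddPart, proj, Prod.mk_zero_zero]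

theorem oddPart_signTwist (X : Vec K E →ₗ[K] Vec K E) : oddPart (signTwist X) = - oddPart X := by
  ext v <;> simp [signTwist, evenPart, oddPart, proj, Prod.mk_zero_zero]

theorem tensorAct_signTwist (X : Vec K E →ₗ[K] Vec K E) :
    tensorAct (B := B) (signTwist X) =
      tensorDer LinearMap.id (evenPart X) + (-1 : K) • tensorDer (parityInv K E) (oddPart X) := by
  rw [tensorAct, evenPart_signTwist, oddPart_signTwist, tensorDer_neg]

theorem parityInv_proj (p : Bool) (v : Vec K E) :
    parityInv K E (proj K E p v) = ((if p then -1 else 1 : ℤ) : K) • proj K E p v := by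
  cases p
  · simp [parityInv, proj_proj]
  · simp [parityInv, proj_proj, neg_smul (1 : K) (proj K E true v)]

theorem tensorDer_even_tprod (X : Vec K E →ₗ[K] Vec K E) {S : Finset B} {x : B → Vec K E}
    (hx : IsHomog S x) :
    tensorDer LinearMap.id (evenPart X) (PiTensorProduct.tprod K x) =
      ∑ b : B, PiTensorProduct.tprod K (Function.update x b (evenPart X (x b))) := by
  rw [tensorDer_tprod _ _ 1 hx (by simp)]
  simp

theorem tensorDer_odd_tprod (X : Vec K E →ₗ[K] Vec K E) {S : Finset B} {x : B → Vec K E}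
    (hx : IsHomog S x) :
    tensorDer (parityInv K E) (oddPart X) (PiTensorProduct.tprod K x) =
      ∑ b : B, ((∏ c ∈ S, if c < b then -1 else 1 : ℤ) : K) •
        PiTensorProduct.tprod K (Function.update x b (oddPart X (x b))) :=
  tensorDer_tprod _ _ (-1) hx parityInv_proj

end SignedPerm

/-! ### Permutations of a skew diagram as permutations of `lam` fixing the removed boxes. -/

section Boxes

variable {K E : Type*} [Field K] [AddCommGroup E] [Module K E]
variable {lam mu : YoungDiagram}

theorem Box.lt_iff {b c : Box lam mu} : b < c ↔ b.col < c.col ∨ b.col = c.col ∧ b.row < c.row :=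
  Prod.Lex.toLex_lt_toLex

@[simp] theorem Box.incl_row (b : Box lam mu) : b.incl.row = b.row := rfl
@[simp] theorem Box.incl_col (b : Box lam mu) : b.incl.col = b.col := rfl

theorem Box.incl_lt {b c : Box lam mu} : b.incl < c.incl ↔ b < c := by
  rw [Box.lt_iff, Box.lt_iff]; rfl

/-- The inclusion of the boxes of `lam / mu` into those of `lam`. -/
def inclEmb : Box lam mu ↪ Box lam ⊥ := ⟨Box.incl, Box.incl_injective⟩

@[simp] theorem inclEmb_apply (b : Box lam mu) : inclEmb b = b.incl := rfl

/-- A permutation of the boxes of `lam / mu`, extended to those of `lam`. -/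
noncomputable def extPerm (σ : Equiv.Perm (Box lam mu)) : Equiv.Perm (Box lam ⊥) :=
  σ.viaFintypeEmbedding inclEmb

@[simp] theorem extPerm_incl (σ : Equiv.Perm (Box lam mu)) (b : Box lam mu) :
    extPerm σ b.incl = (σ b).incl :=
  Equiv.Perm.viaFintypeEmbedding_apply_image σ inclEmb b

theorem extPerm_of_notMem (σ : Equiv.Perm (Box lam mu)) {b : Box lam ⊥}
    (hb : ∀ c : Box lam mu, b ≠ c.incl) : extPerm σ b = b :=
  Equiv.Perm.viaFintypeEmbedding_apply_notMem_range σ inclEmb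
    (by rintro ⟨c, rfl⟩; exact hb c rfl)

theorem extPerm_symm_incl (σ : Equiv.Perm (Box lam mu)) (b : Box lam mu) :
    (extPerm σ).symm b.incl = (σ.symm b).incl := by
  rw [Equiv.symm_apply_eq, extPerm_incl, Equiv.apply_symm_apply]

theorem extPerm_symm_of_notMem (σ : Equiv.Perm (Box lam mu)) {b : Box lam ⊥}
    (hb : ∀ c : Box lam mu, b ≠ c.incl) : (extPerm σ).symm b = b := by
  rw [Equiv.symm_apply_eq, extPerm_of_notMem σ hb]

theorem sign_extPerm (σ : Equiv.Perm (Box lam mu)) :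
    Equiv.Perm.sign (extPerm σ) = Equiv.Perm.sign σ :=
  Equiv.Perm.viaFintypeEmbedding_sign σ inclEmb

theorem koszulSign_extPerm (σ : Equiv.Perm (Box lam mu)) (S : Finset (Box lam mu)) :
    koszulSign (extPerm σ) (S.map inclEmb) = koszulSign σ S := by
  simp only [koszulSign, Finset.prod_map, inclEmb_apply, extPerm_incl, Box.incl_lt]

/-- The boxes of `lam` outside `F` are those of `lam / mu`. -/
theorem sum_stabilizer {F : Finset (Box lam ⊥)} (hF : ∀ b, b ∈ F ↔ ∀ c : Box lam mu, b ≠ c.incl)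
    {r : Box lam ⊥ → ℕ} {M : Type*} [AddCommMonoid M] (f : Equiv.Perm (Box lam ⊥) → M) :
    ∑ σ with σ ∈ stabilizer r F, f σ =
      ∑ σ : Equiv.Perm (Box lam mu) with ∀ b, r (σ b).incl = r b.incl, f (extPerm σ) := by
  symm
  refine Finset.sum_bij (fun σ _ => extPerm σ) ?_ ?_ ?_ fun _ _ => rfl
  · intro σ hσ
    have hσ := (Finset.mem_filter.1 hσ).2
    refine Finset.mem_filter.2 ⟨Finset.mem_univ _, fun b => ?_, fun b hb => ?_⟩
    · by_cases h : ∀ c : Box lam mu, b ≠ c.incl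
      · rw [extPerm_of_notMem σ h]
      · push Not at h
        obtain ⟨c, rfl⟩ := h
        rw [extPerm_incl, hσ]
    · exact extPerm_of_notMem σ ((hF b).1 hb)
  · intro σ _ τ _ h
    ext1 b
    apply Box.incl_injective
    rw [← extPerm_incl, ← extPerm_incl, h]
  · intro σ hσ
    have hσ := (Finset.mem_filter.1 hσ).2
    have hinv := (inv_mem hσ : σ⁻¹ ∈ stabilizer r F)
    -- If a box outside `F` were sent into `F`, its image would be a fixed point, contradicting
    -- injectivity. Applying this to `σ` and `σ⁻¹` produces the restricted permutation and its
    -- inverse.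
    have key : ∀ τ ∈ stabilizer r F, ∀ b : Box lam mu, ∃ c : Box lam mu, τ b.incl = c.incl := by
      intro τ hτ b
      by_contra! h
      have h1 := hτ.2 _ ((hF _).2 h)
      exact h b (τ.injective h1)
    choose s hs using key σ hσ
    choose t ht using key σ⁻¹ hinv
    let τ : Equiv.Perm (Box lam mu) :=
      ⟨s, t, fun b => Box.incl_injective (by rw [← ht, ← hs]; simp),
        fun b => Box.incl_injective (by rw [← hs, ← ht]; simp)⟩
    have hτ : ∀ b, (τ b).incl = σ b.incl := fun b => (hs b).symm
    refine ⟨τ, Finset.mem_filter.2 ⟨Finset.mem_univ _, fun b => ?_⟩, ?_⟩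
    · rw [hτ, hσ.1]
    · ext1 b
      by_cases h : ∀ c : Box lam mu, b ≠ c.incl
      · rw [extPerm_of_notMem τ h, hσ.2 b ((hF b).2 h)]
      · push Not at h
        obtain ⟨c, rfl⟩ := h
        rw [extPerm_incl, hτ]

theorem schurMap_eq : schurMap K E lam mu =
    stabSum K (signedPermHom K E (Box lam mu)) 1 Box.row ∅ *
      stabSum K (signedPermHom K E (Box lam mu)) Equiv.Perm.sign Box.col ∅ := by
  simp only [schurMap, rowSym, colAlt, stabSum, mem_stabilizer, Finset.notMem_empty,
    MonoidHom.one_apply, Units.val_one, Int.cast_one, one_smul, signedPermHom_apply]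
  simp only [false_implies, implies_true, and_true]
  rfl

theorem degProj_schurMap (d : ℤ) (x : TPow K E (Box lam mu)) :
    degProj K E _ d (schurMap K E lam mu x) = schurMap K E lam mu (degProj K E _ d x) := by
  simp only [schurMap, rowSym, colAlt, LinearMap.comp_apply, LinearMap.sum_apply,
    LinearMap.smul_apply, map_sum, map_smul, degProj_signedPerm]

theorem mem_schurPart {d : ℤ} {x : schur K E lam mu} :
    x ∈ schurPart K E lam mu d ↔ degProj K E _ d (x : TPow K E (Box lam mu)) = x :=
  mem_tensorPart

theorem one_mul_sign_swap {B : Type*} [Fintype B] [DecidableEq B] (b c : B) (h : b ≠ c) :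
    (1 : Equiv.Perm B →* ℤˣ) (Equiv.swap b c) * Equiv.Perm.sign (Equiv.swap b c) = -1 := by
  simp [Equiv.Perm.sign_swap h]

end Boxes

section KoszulMin

variable {B : Type*} [Fintype B] [LinearOrder B]

/-- An odd factor that precedes all the others both before and after the permutation is never
crossed. -/
theorem koszulSign_insert_min (σ : Equiv.Perm B) {S : Finset B} {b : B} (hb : b ∉ S)
    (h1 : ∀ c ∈ S, b < c) (h2 : ∀ c ∈ S, σ b < σ c) :
    koszulSign σ (insert b S) = koszulSign σ S := by
  have h := koszulSign_insert σ hb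
  rwa [Finset.prod_eq_one fun c hc => if_neg (h1 c hc).not_gt,
    Finset.prod_eq_one fun c hc => if_neg (h2 c hc).not_gt, mul_one, mul_one] at h

end KoszulMin

/-! ### Filling the first two boxes of the first column. -/

section Homog

variable {K E : Type*} [Field K] [AddCommGroup E] [Module K E]

theorem proj_false_mk (e : E) : proj K E false (e, 0) = (e, 0) := by simp [proj]

theorem proj_true_mk (φ : Module.Dual K E) : proj K E true (0, φ) = (0, φ) := by simp [proj]

theorem evenPart_add_oddPart (X : Vec K E →ₗ[K] Vec K E) (v : Vec K E) :
    evenPart X v + oddPart X v = X v := by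
  rw [← LinearMap.add_apply]
  congr 1
  ext w <;> simp [evenPart, oddPart, proj, Prod.mk_zero_zero]

variable {mu lam : YoungDiagram}

theorem insertVec_tprod (w : ℕ → ℕ → Vec K E) (x : Box lam mu → Vec K E) :
    insertVec mu w (PiTensorProduct.tprod K x) = PiTensorProduct.tprod K (fill mu w x) := by
  rw [insertVec, PiTensorProduct.lift.tprod]; rfl

theorem fill_incl (w : ℕ → ℕ → Vec K E) (x : Box lam mu → Vec K E) (c : Box lam mu) :
    fill mu w x c.incl = x c := by
  have hb : (c.row, c.col) ∉ mu.cells := (Finset.mem_sdiff.1 c.mem).2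
  simp [fill, hb]

theorem fill_of_mem (w : ℕ → ℕ → Vec K E) (x : Box lam mu → Vec K E) {b : Box lam ⊥}
    (hb : (b.row, b.col) ∈ mu.cells) : fill mu w x b = w b.row b.col := by
  simp only [fill, hb, dite_true]

theorem mem_oneOne {i j : ℕ} : (i, j) ∈ oneOne ↔ i < 2 ∧ j = 0 := by
  rw [oneOne, YoungDiagram.mem_ofRowLens]
  constructor
  · rintro ⟨h, h'⟩
    have hi : i < 2 := by simpa using h
    interval_cases i <;> simpa using h'
  · rintro ⟨h, rfl⟩
    refine ⟨by simpa using h, ?_⟩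
    interval_cases i <;> simp

/-- The box `(i, 0)` of `lam`, for `i < 2` and `(1,1) ⊆ lam`. -/
def firstColBox (h : oneOne ≤ lam) (i : Fin 2) : Box lam ⊥ :=
  ⟨i, 0, Finset.mem_sdiff.2 ⟨YoungDiagram.cells_subset_iff.2 h
    ((YoungDiagram.mem_cells _).2 (mem_oneOne.2 ⟨i.2, rfl⟩)), by simp⟩⟩

theorem firstColBox_lt (h : oneOne ≤ lam) : firstColBox h 0 < firstColBox h 1 := by
  simp [Box.lt_iff, firstColBox]

theorem eq_firstColBox_or (h : oneOne ≤ lam) (b : Box lam ⊥) :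
    b = firstColBox h 0 ∨ b = firstColBox h 1 ∨ ∃ c : Box lam oneOne, b = c.incl := by
  obtain ⟨i, j, hb⟩ := b
  by_cases hm : (i, j) ∈ oneOne
  · obtain ⟨hi, rfl⟩ := mem_oneOne.1 hm
    interval_cases i
    · exact Or.inl rfl
    · exact Or.inr (Or.inl rfl)
  · exact Or.inr (Or.inr ⟨⟨i, j, Finset.mem_sdiff.2 ⟨(Finset.mem_sdiff.1 hb).1, hm⟩⟩, rfl⟩)

theorem firstColBox_lt_incl (h : oneOne ≤ lam) (i : Fin 2) (c : Box lam oneOne) :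
    firstColBox h i < c.incl := by
  have hc : (c.row, c.col) ∉ oneOne := fun hc => (Finset.mem_sdiff.1 c.mem).2 hc
  rw [mem_oneOne] at hc
  rw [Box.lt_iff]
  have := i.2
  simp only [firstColBox, Box.incl_row, Box.incl_col]
  lia

theorem firstColBox_ne_incl (h : oneOne ≤ lam) (i : Fin 2) (c : Box lam oneOne) :
    firstColBox h i ≠ c.incl := (firstColBox_lt_incl h i c).ne

theorem firstColBox_notMem_map (h : oneOne ≤ lam) (i : Fin 2) (S : Finset (Box lam oneOne)) :
    firstColBox h i ∉ S.map inclEmb := by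
  simp only [Finset.mem_map, not_exists, not_and]
  exact fun c _ hc => firstColBox_ne_incl h i c hc.symm

/-- The boxes of `lam` are two given ones and those of `lam / mu`. -/
theorem sum_box {M : Type*} [AddCommMonoid M] {b₀ b₁ : Box lam ⊥} (h01 : b₀ ≠ b₁)
    (hc : ∀ b : Box lam ⊥, b = b₀ ∨ b = b₁ ∨ ∃ c : Box lam mu, b = c.incl)
    (h0 : ∀ c : Box lam mu, b₀ ≠ c.incl) (h1 : ∀ c : Box lam mu, b₁ ≠ c.incl)
    (f : Box lam ⊥ → M) : ∑ b, f b = f b₀ + (f b₁ + ∑ c : Box lam mu, f c.incl) := by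
  have hu : (Finset.univ : Finset (Box lam ⊥)) = insert b₀ (insert b₁
      ((Finset.univ : Finset (Box lam mu)).map inclEmb)) := by
    ext b
    rcases hc b with h | h | ⟨c, h⟩ <;> simp [h]
  rw [hu, Finset.sum_insert, Finset.sum_insert, Finset.sum_map]
  · rfl
  · simpa using fun c hc => h1 c hc.symm
  · simpa [h01] using fun c hc => h0 c hc.symm

/-- Filling the first two boxes of the first column with two vectors. -/
noncomputable def insertPair (v w : Vec K E) :
    TPow K E (Box lam oneOne) →ₗ[K] TPow K E (Box lam ⊥) :=
  insertVec oneOne fun r _ => if r = 0 then v else w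

/-- The vectors `v` and `w` on the first two boxes of the first column, and `x` on the others. -/
def fillPair (v w : Vec K E) (x : Box lam oneOne → Vec K E) : Box lam ⊥ → Vec K E :=
  fill oneOne (fun r _ => if r = 0 then v else w) x

theorem insertPair_tprod (v w : Vec K E) (x : Box lam oneOne → Vec K E) :
    insertPair v w (PiTensorProduct.tprod K x) = PiTensorProduct.tprod K (fillPair v w x) :=
  insertVec_tprod _ _

@[simp] theorem fillPair_incl (v w : Vec K E) (x : Box lam oneOne → Vec K E) (c : Box lam oneOne) :
    fillPair v w x c.incl = x c := fill_incl _ _ _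

@[simp] theorem fillPair_zero (h : oneOne ≤ lam) (v w : Vec K E) (x : Box lam oneOne → Vec K E) :
    fillPair v w x (firstColBox h 0) = v := by
  rw [fillPair, fill_of_mem]
  · simp [firstColBox]
  · exact (YoungDiagram.mem_cells _).2 (mem_oneOne.2 (by simp [firstColBox]))

@[simp] theorem fillPair_one (h : oneOne ≤ lam) (v w : Vec K E) (x : Box lam oneOne → Vec K E) :
    fillPair v w x (firstColBox h 1) = w := by
  rw [fillPair, fill_of_mem]
  · simp [firstColBox]
  · exact (YoungDiagram.mem_cells _).2 (mem_oneOne.2 (by simp [firstColBox]))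

theorem eq_fillPair (h : oneOne ≤ lam) {y : Box lam ⊥ → Vec K E} {v w : Vec K E}
    {x : Box lam oneOne → Vec K E} (h0 : y (firstColBox h 0) = v) (h1 : y (firstColBox h 1) = w)
    (hx : ∀ c : Box lam oneOne, y c.incl = x c) : y = fillPair v w x := by
  funext b
  rcases eq_firstColBox_or h b with rfl | rfl | ⟨c, rfl⟩
  · rw [h0, fillPair_zero]
  · rw [h1, fillPair_one]
  · rw [hx, fillPair_incl]

theorem update_fillPair_zero (h : oneOne ≤ lam) (v w v' : Vec K E)
    (x : Box lam oneOne → Vec K E) :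
    Function.update (fillPair v w x) (firstColBox h 0) v' = fillPair v' w x := by
  refine eq_fillPair h (by simp) ?_ fun c => ?_
  · rw [Function.update_of_ne (firstColBox_lt h).ne', fillPair_one]
  · rw [Function.update_of_ne (firstColBox_ne_incl h 0 c).symm, fillPair_incl]

theorem update_fillPair_one (h : oneOne ≤ lam) (v w v' : Vec K E)
    (x : Box lam oneOne → Vec K E) :
    Function.update (fillPair v w x) (firstColBox h 1) v' = fillPair v v' x := by
  refine eq_fillPair h ?_ (by simp) fun c => ?_
  · rw [Function.update_of_ne (firstColBox_lt h).ne, fillPair_zero]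
  · rw [Function.update_of_ne (firstColBox_ne_incl h 1 c).symm, fillPair_incl]

theorem update_fillPair_incl (v w v' : Vec K E) (x : Box lam oneOne → Vec K E)
    (c : Box lam oneOne) :
    Function.update (fillPair v w x) c.incl v' = fillPair v w (Function.update x c v') :=
  (fill_update _ _ _ _ _).symm

/-- `insertPair` as a bilinear map in the two inserted vectors. -/
noncomputable def pairMap (h : oneOne ≤ lam) (z : TPow K E (Box lam oneOne)) :
    Vec K E →ₗ[K] Vec K E →ₗ[K] TPow K E (Box lam ⊥) :=
  have key {P : TPow K E (Box lam oneOne) →ₗ[K] TPow K E (Box lam ⊥)}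
      {Q : TPow K E (Box lam oneOne) →ₗ[K] TPow K E (Box lam ⊥)}
      (hPQ : ∀ x, P (PiTensorProduct.tprod K x) = Q (PiTensorProduct.tprod K x)) : P z = Q z :=
    LinearMap.congr_fun (PiTensorProduct.ext (MultilinearMap.ext hPQ)) z
  LinearMap.mk₂ K (fun v w => insertPair v w z)
    (fun v v' w => key (P := insertPair (v + v') w) (Q := insertPair v w + insertPair v' w)
      fun x => by
        simp only [LinearMap.add_apply, insertPair_tprod]
        rw [← update_fillPair_zero h 0 w (v + v'), MultilinearMap.map_update_add,
          update_fillPair_zero, update_fillPair_zero])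
    (fun r v w => key (P := insertPair (r • v) w) (Q := r • insertPair v w) fun x => by
        simp only [LinearMap.smul_apply, insertPair_tprod]
        rw [← update_fillPair_zero h 0 w (r • v), MultilinearMap.map_update_smul,
          update_fillPair_zero])
    (fun v w w' => key (P := insertPair v (w + w')) (Q := insertPair v w + insertPair v w')
      fun x => by
        simp only [LinearMap.add_apply, insertPair_tprod]
        rw [← update_fillPair_one h v 0 (w + w'), MultilinearMap.map_update_add,
          update_fillPair_one, update_fillPair_one])
    (fun r v w => key (P := insertPair v (r • w)) (Q := r • insertPair v w) fun x => by
        simp only [LinearMap.smul_apply, insertPair_tprod]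
        rw [← update_fillPair_one h v 0 (r • w), MultilinearMap.map_update_smul,
          update_fillPair_one])

@[simp] theorem pairMap_apply (h : oneOne ≤ lam) (z : TPow K E (Box lam oneOne)) (v w : Vec K E) :
    pairMap h z v w = insertPair v w z := rfl

/-- The positions of the odd factors of `fillPair v w x`, for homogeneous `v`, `w` and `x`. -/
noncomputable def pairSet (h : oneOne ≤ lam) (p q : Bool) (S : Finset (Box lam oneOne)) :
    Finset (Box lam ⊥) :=
  (if p then {firstColBox h 0} else ∅) ∪ ((if q then {firstColBox h 1} else ∅) ∪ S.map inclEmb)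

theorem isHomog_fillPair (h : oneOne ≤ lam) {p q : Bool} {v w : Vec K E} (hv : proj K E p v = v)
    (hw : proj K E q w = w) {S : Finset (Box lam oneOne)} {x : Box lam oneOne → Vec K E}
    (hx : IsHomog S x) : IsHomog (pairSet h p q S) (fillPair v w x) := by
  intro b
  have e0 := firstColBox_notMem_map h 0 S
  have e1 := firstColBox_notMem_map h 1 S
  have e2 := (firstColBox_lt h).ne
  rcases eq_firstColBox_or h b with rfl | rfl | ⟨c, rfl⟩
  · have : decide (firstColBox h 0 ∈ pairSet h p q S) = p := by
      cases p <;> cases q <;> simp [pairSet, e0, e2, -Finset.mem_map]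
    rw [this, fillPair_zero, hv]
  · have : decide (firstColBox h 1 ∈ pairSet h p q S) = q := by
      cases p <;> cases q <;> simp [pairSet, e1, e2.symm, -Finset.mem_map]
    rw [this, fillPair_one, hw]
  · have : c.incl ∈ pairSet h p q S ↔ c ∈ S := by
      have f0 := (firstColBox_ne_incl h 0 c).symm
      have f1 := (firstColBox_ne_incl h 1 c).symm
      have : c.incl ∈ S.map inclEmb ↔ c ∈ S := Finset.mem_map' inclEmb
      cases p <;> cases q <;> simp [pairSet, f0, f1, this, -Finset.mem_map]
    simp only [this, fillPair_incl, hx c]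

theorem pairSet_false_true (h : oneOne ≤ lam) (S : Finset (Box lam oneOne)) :
    pairSet h false true S = insert (firstColBox h 1) (S.map inclEmb) := by
  rw [Finset.insert_eq]; simp [pairSet, -Finset.singleton_union]

theorem koszulSign_extPerm_pairSet (h : oneOne ≤ lam) (σ : Equiv.Perm (Box lam oneOne))
    (S : Finset (Box lam oneOne)) :
    koszulSign (extPerm σ) (pairSet h false true S) = koszulSign σ S := by
  rw [pairSet_false_true, koszulSign_insert_min _ (firstColBox_notMem_map h 1 S),
    koszulSign_extPerm]
  · simp only [Finset.mem_map]
    rintro _ ⟨c, _, rfl⟩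
    exact firstColBox_lt_incl h 1 c
  · simp only [Finset.mem_map]
    rintro _ ⟨c, _, rfl⟩
    rw [extPerm_of_notMem σ (firstColBox_ne_incl h 1), inclEmb_apply, extPerm_incl]
    exact firstColBox_lt_incl h 1 _

/-- The transposition of the first two boxes of the first column. -/
noncomputable def colSwap (h : oneOne ≤ lam) : Equiv.Perm (Box lam ⊥) :=
  Equiv.swap (firstColBox h 0) (firstColBox h 1)

theorem colSwap_incl (h : oneOne ≤ lam) (c : Box lam oneOne) : colSwap h c.incl = c.incl :=
  Equiv.swap_apply_of_ne_of_ne (firstColBox_ne_incl h 0 c).symm (firstColBox_ne_incl h 1 c).symm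

/-- The two boxes precede all others, so the only possible crossing is between themselves, and it
counts only when both factors are odd. -/
theorem koszulSign_colSwap (h : oneOne ≤ lam) (p q : Bool) (S : Finset (Box lam oneOne)) :
    koszulSign (colSwap h) (pairSet h p q S) = if p && q then -1 else 1 := by
  have e0 := firstColBox_notMem_map h 0 S
  have e1 := firstColBox_notMem_map h 1 S
  have h0 : koszulSign (colSwap h) (S.map inclEmb) = 1 := by
    refine Finset.prod_eq_one fun i hi => Finset.prod_eq_one fun j hj => if_neg ?_
    simp only [Finset.mem_map] at hi hj
    obtain ⟨i, _, rfl⟩ := hi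
    obtain ⟨j, _, rfl⟩ := hj
    rw [inclEmb_apply, inclEmb_apply, colSwap_incl, colSwap_incl]
    exact fun h => h.1.not_gt h.2
  have hmin (i : Fin 2) :
      koszulSign (colSwap h) (insert (firstColBox h i) (S.map inclEmb)) = 1 := by
    rw [koszulSign_insert_min _ (firstColBox_notMem_map h i S), h0]
    · simp only [Finset.mem_map]
      rintro _ ⟨c, _, rfl⟩
      exact firstColBox_lt_incl h i c
    · simp only [Finset.mem_map]
      rintro _ ⟨c, _, rfl⟩
      rw [inclEmb_apply, colSwap_incl]
      fin_cases i <;> simp [colSwap, firstColBox_lt_incl]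
  cases p <;> cases q
  · simpa [pairSet] using h0
  · simpa [pairSet_false_true] using hmin 1
  · have := hmin 0
    rw [Finset.insert_eq] at this
    simpa [pairSet, -Finset.singleton_union] using this
  · have hne := (firstColBox_lt h).ne
    have hb : firstColBox h 0 ∉ insert (firstColBox h 1) (S.map inclEmb) := by
      rw [Finset.mem_insert, not_or]; exact ⟨hne, e0⟩
    have hk := koszulSign_insert (colSwap h) hb
    rw [Finset.prod_eq_one, hmin 1, Finset.prod_insert e1, Finset.prod_eq_one] at hk
    · have : pairSet h true true S =
          insert (firstColBox h 0) (insert (firstColBox h 1) (S.map inclEmb)) := by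
        rw [Finset.insert_eq, Finset.insert_eq]; simp [pairSet, -Finset.singleton_union]
      rw [this]
      simpa [colSwap, firstColBox_lt h] using hk
    · simp only [Finset.mem_map]
      rintro _ ⟨c, _, rfl⟩
      rw [inclEmb_apply, colSwap_incl, if_neg]
      simpa [colSwap] using (firstColBox_lt_incl h 1 c).le
    · intro c hc
      rw [if_neg]
      rcases Finset.mem_insert.1 hc with rfl | hc
      · exact (firstColBox_lt h).not_gt
      · simp only [Finset.mem_map] at hc
        obtain ⟨c, _, rfl⟩ := hc
        exact (firstColBox_lt_incl h 0 c).not_gt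

theorem signedPerm_colSwap_insertPair (h : oneOne ≤ lam) {p q : Bool} {v w : Vec K E}
    (hv : proj K E p v = v) (hw : proj K E q w = w) (z : TPow K E (Box lam oneOne)) :
    signedPerm K E (colSwap h) (insertPair v w z) =
      ((if p && q then -1 else 1 : ℤ) : K) • insertPair w v z := by
  refine LinearMap.congr_fun (f := signedPerm K E (colSwap h) ∘ₗ insertPair v w)
    (g := ((if p && q then -1 else 1 : ℤ) : K) • insertPair w v) (ext_homog ?_) z
  intro S x hx
  rw [LinearMap.comp_apply, LinearMap.smul_apply, insertPair_tprod, insertPair_tprod,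
    signedPerm_tprod _ (isHomog_fillPair h hv hw hx), koszulSign_colSwap]
  congr 2
  refine eq_fillPair h ?_ ?_ fun c => ?_
  · simp [colSwap]
  · simp [colSwap]
  · rw [(Equiv.symm_apply_eq _).2 (colSwap_incl h c).symm, fillPair_incl]

theorem schurMap_signedPerm_col {mu : YoungDiagram} {σ : Equiv.Perm (Box lam mu)}
    (hσ : ∀ b, (σ b).col = b.col) (y : TPow K E (Box lam mu)) :
    schurMap K E lam mu (signedPerm K E σ y) =
      ((Equiv.Perm.sign σ : ℤ) : K) • schurMap K E lam mu y := by
  have hm : σ ∈ stabilizer (Box.col : Box lam mu → ℕ) ∅ := ⟨hσ, by simp⟩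
  have h := stabSum_mul (K := K) (ρ := signedPermHom K E (Box lam mu)) (ε := Equiv.Perm.sign) hm
  rw [schurMap_eq, ← signedPermHom_apply, ← Module.End.mul_apply, mul_assoc, h, mul_smul_comm,
    LinearMap.smul_apply]

/-- The two inserted factors lie in one column, so the Schur map sees only their class in `⋀² V`:
antisymmetric in even vectors and symmetric in odd ones. -/
theorem schurMap_insertPair_comm (h : oneOne ≤ lam) {p q : Bool} {v w : Vec K E}
    (hv : proj K E p v = v) (hw : proj K E q w = w) (z : TPow K E (Box lam oneOne)) :
    schurMap K E lam ⊥ (insertPair v w z) =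
      ((if p && q then 1 else -1 : ℤ) : K) • schurMap K E lam ⊥ (insertPair w v z) := by
  have h1 := schurMap_signedPerm_col (K := K) (E := E) (σ := colSwap h) (fun b => ?_)
    (insertPair v w z)
  · rw [signedPerm_colSwap_insertPair h hv hw, map_smul, colSwap,
      Equiv.Perm.sign_swap (firstColBox_lt h).ne] at h1
    have h2 := congrArg (fun y => (-1 : K) • y) h1
    cases p <;> cases q <;> simpa [smul_smul] using h2.symm
  · exact (swap_mem_stabilizer (r := Box.col) (F := ∅) (b := firstColBox h 0)
      (c := firstColBox h 1) rfl (by simp) (by simp)).1 b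

end Homog

/-! ### Equivariance of the trace. -/

section TraceInvariance

variable {K E : Type*} [Field K] [CharZero K] [AddCommGroup E] [Module K E]

/-- A pairing on `V` that is antisymmetric on `E` and symmetric on `E*` kills the image of the trace
element under `pe(V)`. -/
theorem sum_bilin_trace {M : Type*} [AddCommMonoid M] [Module K M] {ι : Type*} [Fintype ι]
    [DecidableEq ι] (b : Module.Basis ι K E) (β : Vec K E →ₗ[K] Vec K E →ₗ[K] M)
    (h0 : ∀ e e' : E, β (e, 0) (e', 0) = (-1 : K) • β (e', 0) (e, 0))
    (h1 : ∀ φ ψ : Module.Dual K E, β (0, φ) (0, ψ) = β (0, ψ) (0, φ))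
    {X : Vec K E →ₗ[K] Vec K E} (hX : X ∈ periplectic K E) :
    ∑ i, (β (X (b i, 0)) (0, b.coord i) + β (b i, 0) (X (0, b.coord i))) = 0 := by
  obtain ⟨k1, k2, k3⟩ := hX
  have hE (e : E) : ((e, 0) : Vec K E) = ∑ j, b.coord j e • ((b j, 0) : Vec K E) := by
    have : LinearMap.inl K E (Module.Dual K E) e =
        ∑ j, b.coord j e • LinearMap.inl K E (Module.Dual K E) (b j) := by
      conv_lhs => rw [← b.sum_repr e]
      simp only [map_sum, map_smul, Module.Basis.coord_apply]
    exact this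
  have hD (φ : Module.Dual K E) :
      ((0, φ) : Vec K E) = ∑ j, φ (b j) • ((0, b.coord j) : Vec K E) := by
    have : LinearMap.inr K E (Module.Dual K E) φ =
        ∑ j, φ (b j) • LinearMap.inr K E (Module.Dual K E) (b.coord j) := by
      conv_lhs => rw [← b.sum_dual_apply_smul_coord φ]
      simp only [map_sum, map_smul]
    exact this
  have hs (v : Vec K E) : v = ∑ j, b.coord j v.1 • ((b j, 0) : Vec K E) +
      ∑ j, v.2 (b j) • ((0, b.coord j) : Vec K E) := by
    rw [← hE, ← hD]; simp
  have e1 (i : ι) : β (X (b i, 0)) (0, b.coord i) =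
      ∑ j, b.coord j (X (b i, 0)).1 • β (b j, 0) (0, b.coord i) +
        ∑ j, (X (b i, 0)).2 (b j) • β (0, b.coord j) (0, b.coord i) := by
    conv_lhs => rw [hs (X (b i, 0))]
    simp only [map_add, map_sum, map_smul, LinearMap.add_apply, LinearMap.sum_apply,
      LinearMap.smul_apply]
  have e2 (i : ι) : β (b i, 0) (X (0, b.coord i)) =
      ∑ j, b.coord j (X (0, b.coord i)).1 • β (b i, 0) (b j, 0) +
        ∑ j, (-1 : K) • b.coord i (X (b j, 0)).1 • β (b i, 0) (0, b.coord j) := by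
    conv_lhs => rw [hs (X (0, b.coord i))]
    simp only [map_add, map_sum, map_smul, k1, smul_smul, neg_one_mul]
  -- Skew coefficients from the block `E → E*` meet a symmetric form, so the sum is its own
  -- negative. In `s2` the roles are reversed: the block `E* → E` is symmetric and the form is skew.
  have s1 : ∑ i, ∑ j, (X (b i, 0)).2 (b j) • β (0, b.coord j) (0, b.coord i) = 0 := by
    apply eq_zero_of_eq_neg_smul (K := K)
    conv_lhs => rw [Finset.sum_comm]
    simp only [Finset.smul_sum, smul_smul]
    refine Finset.sum_congr rfl fun i _ => Finset.sum_congr rfl fun j _ => ?_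
    rw [k3, h1]
    simp
  have s2 : ∑ i, ∑ j, b.coord j (X (0, b.coord i)).1 • β (b i, 0) (b j, 0) = 0 := by
    apply eq_zero_of_eq_neg_smul (K := K)
    conv_lhs => rw [Finset.sum_comm]
    simp only [Finset.smul_sum]
    refine Finset.sum_congr rfl fun i _ => Finset.sum_congr rfl fun j _ => ?_
    rw [k2, h0, smul_comm]
  simp only [e1, e2, Finset.sum_add_distrib]
  rw [s1, s2, add_zero, zero_add]
  -- What remains is the invariance of the trace under `gl(E)`: the block on `E*` is minus the
  -- transpose, and exchanging the summation indices exhibits the cancellation.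
  conv_lhs => enter [2]; rw [Finset.sum_comm]
  rw [← Finset.sum_add_distrib]
  refine Finset.sum_eq_zero fun i _ => ?_
  rw [← Finset.smul_sum]
  generalize ∑ j, b.coord j (X (b i, 0)).1 • β (b j, 0) (0, b.coord i) = y
  nth_rewrite 1 [← one_smul K y]
  rw [← add_smul, add_neg_cancel, zero_smul]

variable [FiniteDimensional K E] {lam : YoungDiagram}

theorem insertTrace_apply (z : TPow K E (Box lam oneOne)) :
    insertTrace K E lam z = ∑ i, insertPair (Module.finBasis K E i, 0)
      (0, (Module.finBasis K E).coord i) z := by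
  rw [insertTrace, LinearMap.sum_apply]; rfl

theorem insertTrace_signedPerm (h : oneOne ≤ lam) (σ : Equiv.Perm (Box lam oneOne))
    (z : TPow K E (Box lam oneOne)) :
    insertTrace K E lam (signedPerm K E σ z) =
      signedPerm K E (extPerm σ) (insertTrace K E lam z) := by
  simp only [insertTrace_apply, map_sum]
  refine Finset.sum_congr rfl fun i _ => ?_
  set v : Vec K E := (Module.finBasis K E i, 0)
  set w : Vec K E := (0, (Module.finBasis K E).coord i)
  refine LinearMap.congr_fun (f := insertPair v w ∘ₗ signedPerm K E σ)
    (g := signedPerm K E (extPerm σ) ∘ₗ insertPair v w) (ext_homog ?_) z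
  intro S x hx
  have hfill := isHomog_fillPair (p := false) (q := true) h (v := v) (w := w) (proj_false_mk _)
    (proj_true_mk _) hx
  rw [LinearMap.comp_apply, LinearMap.comp_apply, signedPerm_tprod σ hx, map_smul,
    insertPair_tprod, insertPair_tprod, signedPerm_tprod _ hfill, koszulSign_extPerm_pairSet]
  congr 2
  symm
  refine eq_fillPair h ?_ ?_ fun c => ?_
  · rw [extPerm_symm_of_notMem σ (firstColBox_ne_incl h 0), fillPair_zero]
  · rw [extPerm_symm_of_notMem σ (firstColBox_ne_incl h 1), fillPair_one]
  · rw [extPerm_symm_incl, fillPair_incl]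

theorem degProj_insertTrace (h : oneOne ≤ lam) (d : ℤ) (z : TPow K E (Box lam oneOne)) :
    degProj K E _ d (insertTrace K E lam z) = insertTrace K E lam (degProj K E _ (d - 1) z) := by
  refine degProj_comp (fun S x hx => ?_) z
  simp only [insertTrace_apply, map_sum]
  have hite : (if (S.card : ℤ) = d - 1 then ∑ i, insertPair (Module.finBasis K E i, 0)
      (0, (Module.finBasis K E).coord i) (PiTensorProduct.tprod K x) else 0) =
      ∑ i, if (S.card : ℤ) = d - 1 then insertPair (lam := lam) (Module.finBasis K E i, 0)
      (0, (Module.finBasis K E).coord i) (PiTensorProduct.tprod K x) else 0 := by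
    split_ifs <;> simp
  rw [hite]
  refine Finset.sum_congr rfl fun i _ => ?_
  rw [insertPair_tprod, degProj_tprod (isHomog_fillPair (p := false) (q := true) h
    (proj_false_mk _) (proj_true_mk _) hx), pairSet_false_true,
    Finset.card_insert_of_notMem (firstColBox_notMem_map h 1 S), Finset.card_map]
  congr 1
  push_cast
  exact propext eq_sub_iff_add_eq.symm

/-- The Leibniz rule. An odd `X` reaching the remaining factors passes `eᵢ*`, the one odd vector of
each inserted pair, and acquires the sign recorded by `signTwist`. The correction sum is the action
on the pair itself; it is left in place because it disappears only after antisymmetrization. -/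
theorem tensorAct_insertTrace (h : oneOne ≤ lam) (X : Vec K E →ₗ[K] Vec K E)
    (z : TPow K E (Box lam oneOne)) :
    tensorAct X (insertTrace K E lam z) = insertTrace K E lam (tensorAct (signTwist X) z) +
      ∑ i, (insertPair (X (Module.finBasis K E i, 0)) (0, (Module.finBasis K E).coord i) z +
        insertPair (Module.finBasis K E i, 0) (X (0, (Module.finBasis K E).coord i)) z) := by
  simp only [insertTrace_apply, map_sum]
  rw [← Finset.sum_add_distrib]
  refine Finset.sum_congr rfl fun i _ => ?_
  set v : Vec K E := (Module.finBasis K E i, 0)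
  set w : Vec K E := (0, (Module.finBasis K E).coord i)
  refine LinearMap.congr_fun (f := tensorAct X ∘ₗ insertPair v w)
    (g := insertPair v w ∘ₗ tensorAct (signTwist X) + (insertPair (X v) w + insertPair v (X w)))
    (ext_homog ?_) z
  intro S x hx
  have hfill := isHomog_fillPair (p := false) (q := true) h (v := v) (w := w) (proj_false_mk _)
    (proj_true_mk _) hx
  have hXv : insertPair (X v) w (PiTensorProduct.tprod K x) =
      PiTensorProduct.tprod K (fillPair (evenPart X v) w x) +
        PiTensorProduct.tprod K (fillPair (oddPart X v) w x) := by
    rw [← evenPart_add_oddPart, ← pairMap_apply h, map_add, LinearMap.add_apply, pairMap_apply,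
      pairMap_apply, insertPair_tprod, insertPair_tprod]
  have hXw : insertPair v (X w) (PiTensorProduct.tprod K x) =
      PiTensorProduct.tprod K (fillPair v (evenPart X w) x) +
        PiTensorProduct.tprod K (fillPair v (oddPart X w) x) := by
    rw [← evenPart_add_oddPart, ← pairMap_apply h, map_add, pairMap_apply,
      pairMap_apply, insertPair_tprod, insertPair_tprod]
  have hsum := fun f : Box lam ⊥ → TPow K E (Box lam ⊥) => sum_box (firstColBox_lt h).ne
    (eq_firstColBox_or h) (firstColBox_ne_incl h 0) (firstColBox_ne_incl h 1) f
  have hs0 : (∏ c ∈ pairSet h false true S, if c < firstColBox h 0 then (-1 : ℤ) else 1) = 1 := by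
    refine Finset.prod_eq_one fun c _ => if_neg ?_
    rcases eq_firstColBox_or h c with rfl | rfl | ⟨c, rfl⟩
    · exact lt_irrefl _
    · exact (firstColBox_lt h).not_gt
    · exact (firstColBox_lt_incl h 0 c).not_gt
  have hs1 : (∏ c ∈ pairSet h false true S, if c < firstColBox h 1 then (-1 : ℤ) else 1) = 1 := by
    rw [pairSet_false_true]
    refine Finset.prod_eq_one fun c hc => if_neg ?_
    rcases Finset.mem_insert.1 hc with rfl | hc
    · exact lt_irrefl _
    · simp only [Finset.mem_map] at hc
      obtain ⟨c, _, rfl⟩ := hc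
      exact (firstColBox_lt_incl h 1 c).not_gt
  -- The extra minus sign is the contribution of the odd vector on the box `(1, 0)`.
  have hs2 (b : Box lam oneOne) :
      (∏ c ∈ pairSet h false true S, if c < b.incl then (-1 : ℤ) else 1) =
        - ∏ c ∈ S, if c < b then (-1 : ℤ) else 1 := by
    rw [pairSet_false_true, Finset.prod_insert (firstColBox_notMem_map h 1 S), Finset.prod_map,
      if_pos (firstColBox_lt_incl h 1 b), neg_one_mul]
    simp only [inclEmb_apply, Box.incl_lt]
  have heven : tensorDer LinearMap.id (evenPart X) (PiTensorProduct.tprod K (fillPair v w x)) =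
      PiTensorProduct.tprod K (fillPair (evenPart X v) w x) +
        (PiTensorProduct.tprod K (fillPair v (evenPart X w) x) + insertPair v w
          (tensorDer LinearMap.id (evenPart X) (PiTensorProduct.tprod K x))) := by
    rw [tensorDer_even_tprod X hfill, tensorDer_even_tprod X hx, hsum]
    simp only [fillPair_zero h, fillPair_one h, update_fillPair_zero, update_fillPair_one,
      update_fillPair_incl, fillPair_incl, map_sum, insertPair_tprod]
  have hodd : tensorDer (parityInv K E) (oddPart X) (PiTensorProduct.tprod K (fillPair v w x)) =
      PiTensorProduct.tprod K (fillPair (oddPart X v) w x) +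
        (PiTensorProduct.tprod K (fillPair v (oddPart X w) x) + (-1 : K) • insertPair v w
          (tensorDer (parityInv K E) (oddPart X) (PiTensorProduct.tprod K x))) := by
    rw [tensorDer_odd_tprod X hfill, tensorDer_odd_tprod X hx, hsum, hs0, hs1]
    simp only [fillPair_zero h, fillPair_one h, update_fillPair_zero, update_fillPair_one,
      update_fillPair_incl, fillPair_incl, map_sum, insertPair_tprod, map_smul, Int.cast_one,
      one_smul, hs2, Finset.smul_sum, smul_smul, Int.cast_neg, neg_one_mul]
  rw [LinearMap.add_apply, LinearMap.add_apply, LinearMap.comp_apply, LinearMap.comp_apply,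
    insertPair_tprod, tensorAct_signTwist, tensorAct, LinearMap.add_apply, LinearMap.add_apply,
    heven, hodd, hXv, hXw, map_add, LinearMap.smul_apply, map_smul]
  abel

theorem schurMap_tensorAct_insertTrace (h : oneOne ≤ lam) {X : Vec K E →ₗ[K] Vec K E}
    (hX : X ∈ periplectic K E) (z : TPow K E (Box lam oneOne)) :
    schurMap K E lam ⊥ (tensorAct X (insertTrace K E lam z)) =
      schurMap K E lam ⊥ (insertTrace K E lam (tensorAct (signTwist X) z)) := by
  rw [tensorAct_insertTrace h, map_add]
  have := sum_bilin_trace (Module.finBasis K E)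
    ((pairMap h z).compr₂ (schurMap K E lam ⊥)) ?_ ?_ hX
  · simp only [LinearMap.compr₂_apply, pairMap_apply, ← map_add, ← map_sum] at this
    rw [this, add_zero]
  · intro e e'
    have := schurMap_insertPair_comm h (proj_false_mk (K := K) e) (proj_false_mk e') z
    simpa using this
  · intro φ ψ
    have := schurMap_insertPair_comm h (proj_true_mk φ) (proj_true_mk ψ) z
    simpa using this

end TraceInvariance

/-! ### Invariance of the evaluation pairing on two factors. -/

section Pairing

variable {K E : Type*} [Field K] [AddCommGroup E] [Module K E]

theorem evalPairing_eq_zero {p : Bool} {v w : Vec K E} (hv : proj K E p v = v)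
    (hw : proj K E p w = w) : evalPairing v w = 0 := by
  rw [← hv, ← hw]
  cases p <;> simp [evalPairing, proj]

theorem evalPairing_evenPart {X : Vec K E →ₗ[K] Vec K E} (hX : X ∈ periplectic K E)
    (v w : Vec K E) : evalPairing (evenPart X v) w + evalPairing v (evenPart X w) = 0 := by
  obtain ⟨k1, -, -⟩ := hX
  simp [evalPairing, evenPart, proj, k1]
  ring

/-- On two even vectors only the block `E → E*` enters, and its skewness gives the cancellation. -/
theorem evalPairing_oddPart_even {X : Vec K E →ₗ[K] Vec K E} (hX : X ∈ periplectic K E)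
    {v w : Vec K E} (hv : proj K E false v = v) (hw : proj K E false w = w) :
    evalPairing (oddPart X v) w + evalPairing v (oddPart X w) = 0 := by
  obtain ⟨-, -, k3⟩ := hX
  rw [← hv, ← hw]
  simp [evalPairing, oddPart, proj, Prod.mk_zero_zero, k3 v.1 w.1]

/-- On two odd vectors only the symmetric block `E* → E` enters. The Koszul sign of passing the
first, odd, vector will turn this equality into a cancellation. -/
theorem evalPairing_oddPart_odd {X : Vec K E →ₗ[K] Vec K E} (hX : X ∈ periplectic K E)
    {v w : Vec K E} (hv : proj K E true v = v) (hw : proj K E true w = w) :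
    evalPairing (oddPart X v) w = evalPairing v (oddPart X w) := by
  obtain ⟨-, k2, -⟩ := hX
  rw [← hv, ← hw]
  simp [evalPairing, oddPart, proj, Prod.mk_zero_zero, k2 v.2 w.2]

end Pairing

theorem prod_symmDiff_singleton {B : Type*} [DecidableEq B] (f : B → ℤ) (S : Finset B) (b : B)
    (hf : f b * f b = 1) : ∏ c ∈ symmDiff S {b}, f c = f b * ∏ c ∈ S, f c := by
  by_cases hb : b ∈ S
  · have hS : symmDiff S {b} = S.erase b := by
      ext c
      by_cases h : c = b <;> simp [Finset.mem_symmDiff, h, hb]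
    rw [hS, ← Finset.mul_prod_erase S f hb, ← mul_assoc, hf, one_mul]
  · have hS : symmDiff S {b} = insert b S := by
      ext c
      by_cases h : c = b <;> simp [Finset.mem_symmDiff, h, hb]
    rw [hS, Finset.prod_insert hb]

/-! ### Signs and equivariance of the evaluation in the first row. -/

section EvalRow

variable {K E : Type*} [Field K] [AddCommGroup E] [Module K E] {lam : YoungDiagram}

theorem firstRowBox_lt (h : two ≤ lam) : firstRowBox h 0 < firstRowBox h 1 := by
  simp [Box.lt_iff, firstRowBox]

theorem firstRowBox_lt_incl (h : two ≤ lam) (c : Box lam two) : firstRowBox h 0 < c.incl := by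
  have hc : (c.row, c.col) ∉ two := fun hc => (Finset.mem_sdiff.1 c.mem).2 hc
  rw [mem_two] at hc
  rw [Box.lt_iff]
  simp only [firstRowBox, Box.incl_row, Box.incl_col]
  lia

/-- The positions in `lam / (2)` among the positions `S` in `lam`. -/
noncomputable def restrictSet (S : Finset (Box lam ⊥)) : Finset (Box lam two) :=
  Finset.univ.filter fun c => c.incl ∈ S

theorem mem_restrictSet {S : Finset (Box lam ⊥)} {c : Box lam two} :
    c ∈ restrictSet S ↔ c.incl ∈ S := by simp [restrictSet]

theorem IsHomog.restrict {S : Finset (Box lam ⊥)} {x : Box lam ⊥ → Vec K E} (hx : IsHomog S x) :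
    IsHomog (restrictSet S) fun c : Box lam two => x c.incl := by
  intro c
  simpa only [mem_restrictSet] using hx c.incl

/-- The sign in `evalRow` on the tensors that are odd exactly on `S`. -/
noncomputable def rowSign (h : two ≤ lam) (S : Finset (Box lam ⊥)) : ℤ :=
  if firstRowBox h 1 ∈ S then
    ∏ c ∈ S, if firstRowBox h 0 < c ∧ c < firstRowBox h 1 then -1 else 1 else 1

theorem evalRow_tprod (h : two ≤ lam) {S : Finset (Box lam ⊥)} {x : Box lam ⊥ → Vec K E}
    (hx : IsHomog S x) : evalRow K E h (PiTensorProduct.tprod K x) =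
      (rowSign h S : K) • evalPairing (x (firstRowBox h 0)) (x (firstRowBox h 1)) •
        PiTensorProduct.tprod K (fun c : Box lam two => x c.incl) := by
  rw [evalRow, LinearMap.sum_apply, Finset.sum_eq_single S]
  · rw [LinearMap.smul_apply, LinearMap.comp_apply, tensorProj_tprod hx, if_pos rfl, contract,
      PiTensorProduct.lift.tprod, rowSign]
    congr 1
    split_ifs
    · rw [Finset.prod_ite]; simp
    · simp
  · intro S' _ hS
    rw [LinearMap.smul_apply, LinearMap.comp_apply, tensorProj_tprod hx, if_neg hS, map_zero,
      smul_zero]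
  · simp

/-- Either the contraction of a homogeneous tensor vanishes, or exactly one of the two contracted
factors is odd. -/
theorem evalPairing_eq_zero_or (h : two ≤ lam) {S : Finset (Box lam ⊥)}
    {x : Box lam ⊥ → Vec K E} (hx : IsHomog S x) :
    evalPairing (x (firstRowBox h 0)) (x (firstRowBox h 1)) = 0 ∨
      S = insert (firstRowBox h 0) ((restrictSet S).map inclEmb) ∨
      S = insert (firstRowBox h 1) ((restrictSet S).map inclEmb) := by
  have key (i j : Fin 2) (hij : ∀ k, k = i ∨ k = j) (hi : firstRowBox h i ∈ S)
      (hj : firstRowBox h j ∉ S) :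
      S = insert (firstRowBox h i) ((restrictSet S).map inclEmb) := by
    have hb : ∀ b : Box lam ⊥, b = firstRowBox h i ∨ b = firstRowBox h j ∨
        ∃ c : Box lam two, b = c.incl := fun b => by
      rcases eq_firstRowBox_or h b with rfl | rfl | h
      · rcases hij 0 with h | h <;> simp [h]
      · rcases hij 1 with h | h <;> simp [h]
      · exact Or.inr (Or.inr h)
    ext b
    rw [Finset.mem_insert, Finset.mem_map]
    constructor
    · intro hbS
      rcases hb b with rfl | rfl | ⟨c, rfl⟩
      · exact Or.inl rfl
      · exact absurd hbS hj
      · exact Or.inr ⟨c, mem_restrictSet.2 hbS, rfl⟩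
    · rintro (rfl | ⟨c, hc, rfl⟩)
      · exact hi
      · exact mem_restrictSet.1 hc
  have h0 := hx (firstRowBox h 0)
  have h1 := hx (firstRowBox h 1)
  by_cases c0 : firstRowBox h 0 ∈ S <;> by_cases c1 : firstRowBox h 1 ∈ S
  · simp only [c0, c1] at h0 h1
    exact Or.inl (evalPairing_eq_zero h0 h1)
  · exact Or.inr (Or.inl (key 0 1 (by decide) c0 c1))
  · exact Or.inr (Or.inr (key 1 0 (by decide) c1 c0))
  · simp only [c0, c1] at h0 h1
    exact Or.inl (evalPairing_eq_zero h0 h1)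

theorem firstRowBox_notMem_map (h : two ≤ lam) (i : Fin 2) (S : Finset (Box lam two)) :
    firstRowBox h i ∉ S.map inclEmb := by
  simp only [Finset.mem_map, not_exists, not_and]
  exact fun c _ hc => incl_ne_firstRowBox h c i hc.symm

theorem firstRowBox_one_notMem (h : two ≤ lam) (S : Finset (Box lam two)) :
    firstRowBox h 1 ∉ insert (firstRowBox h 0) (S.map inclEmb) := by
  rw [Finset.mem_insert, not_or]
  exact ⟨(firstRowBox_ne h).symm, firstRowBox_notMem_map h 1 S⟩

theorem rowSign_insert_zero (h : two ≤ lam) (S : Finset (Box lam two)) :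
    rowSign h (insert (firstRowBox h 0) (S.map inclEmb)) = 1 :=
  if_neg (firstRowBox_one_notMem h S)

theorem rowSign_insert_one (h : two ≤ lam) (S : Finset (Box lam two)) :
    rowSign h (insert (firstRowBox h 1) (S.map inclEmb)) =
      ∏ c ∈ S, if c.incl < firstRowBox h 1 then -1 else 1 := by
  rw [rowSign, if_pos (Finset.mem_insert_self _ _),
    Finset.prod_insert (firstRowBox_notMem_map h 1 S), Finset.prod_map]
  simp [firstRowBox_lt_incl]

theorem map_extPerm_insert (h : two ≤ lam) (σ : Equiv.Perm (Box lam two)) (i : Fin 2)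
    (S : Finset (Box lam two)) :
    (insert (firstRowBox h i) (S.map inclEmb)).map (extPerm σ).toEmbedding =
      insert (firstRowBox h i) ((S.map σ.toEmbedding).map inclEmb) := by
  rw [Finset.map_insert]
  congr 1
  · exact extPerm_of_notMem σ fun c => incl_ne_firstRowBox h c i
  · rw [Finset.map_map, Finset.map_map]
    congr 1
    ext c <;> simp

/-- When the odd contracted factor is on `(0, 0)` nothing crosses it. When it is on `(0, 1)`, the
crossings with the permuted factors are exactly the change in the sign built into `evalRow`. -/
theorem evalRow_signedPerm (h : two ≤ lam) (σ : Equiv.Perm (Box lam two))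
    (z : TPow K E (Box lam ⊥)) :
    evalRow K E h (signedPerm K E (extPerm σ) z) = signedPerm K E σ (evalRow K E h z) := by
  refine LinearMap.congr_fun (f := evalRow K E h ∘ₗ signedPerm K E (extPerm σ))
    (g := signedPerm K E σ ∘ₗ evalRow K E h) (ext_homog ?_) z
  intro S x hx
  have e (i : Fin 2) : (extPerm σ).symm (firstRowBox h i) = firstRowBox h i :=
    extPerm_symm_of_notMem σ fun c => incl_ne_firstRowBox h c i
  rw [LinearMap.comp_apply, LinearMap.comp_apply, signedPerm_tprod _ hx, map_smul,
    evalRow_tprod h (hx.perm _), evalRow_tprod h hx, map_smul, map_smul,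
    signedPerm_tprod σ hx.restrict]
  simp only [e, extPerm_symm_incl]
  rcases evalPairing_eq_zero_or h hx with h0 | h0 | h0
  · rw [h0]; simp
  · generalize restrictSet S = S' at h0 ⊢
    subst h0
    rw [map_extPerm_insert, rowSign_insert_zero, rowSign_insert_zero, koszulSign_insert_min,
      koszulSign_extPerm, smul_smul, smul_smul, smul_smul, smul_smul]
    · congr 1; push_cast; ring
    · exact firstRowBox_notMem_map h 0 S'
    · simp only [Finset.mem_map]
      rintro _ ⟨c, _, rfl⟩
      exact firstRowBox_lt_incl h c
    · simp only [Finset.mem_map]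
      rintro _ ⟨c, _, rfl⟩
      rw [extPerm_of_notMem σ fun c => incl_ne_firstRowBox h c 0, inclEmb_apply, extPerm_incl]
      exact firstRowBox_lt_incl h _
  · generalize restrictSet S = S' at h0 ⊢
    subst h0
    have hk := koszulSign_insert (extPerm σ) (firstRowBox_notMem_map h 1 S')
    rw [koszulSign_extPerm, extPerm_of_notMem σ fun c => incl_ne_firstRowBox h c 1,
      Finset.prod_map, Finset.prod_map] at hk
    replace hk : koszulSign (extPerm σ) (insert (firstRowBox h 1) (S'.map inclEmb)) *
        (∏ c ∈ S', if c.incl < firstRowBox h 1 then (-1 : ℤ) else 1) = koszulSign σ S' *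
        (∏ c ∈ S', if (σ c).incl < firstRowBox h 1 then (-1 : ℤ) else 1) := by
      refine hk.trans (congrArg _ (Finset.prod_congr rfl fun c _ => if_congr ?_ rfl rfl))
      rw [inclEmb_apply, extPerm_incl]
    rw [map_extPerm_insert, rowSign_insert_one, rowSign_insert_one, Finset.prod_map,
      smul_smul, smul_smul, smul_smul, smul_smul]
    congr 1
    have s1 := prod_sign_mul_self (p := fun c => c.incl < firstRowBox h 1) S'
    have s2 := prod_sign_mul_self (p := fun c => (σ c).incl < firstRowBox h 1) S'
    simp only [Equiv.coe_toEmbedding]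
    generalize (∏ c ∈ S', if c.incl < firstRowBox h 1 then (-1 : ℤ) else 1) = u at *
    generalize (∏ c ∈ S', if (σ c).incl < firstRowBox h 1 then (-1 : ℤ) else 1) = w at *
    generalize koszulSign (extPerm σ) (insert (firstRowBox h 1) (S'.map inclEmb)) = k at *
    -- Since `u` and `w` are signs, they may be exchanged between the two sides of `hk`.
    have hk' : k * w = u * koszulSign σ S' := by
      linear_combination (-k * w) * s1 + koszulSign σ S' * u * s2 + w * u * hk
    have hk'' := congrArg (Int.cast (R := K)) hk'
    rw [Int.cast_mul, Int.cast_mul] at hk''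
    linear_combination (evalPairing (x (firstRowBox h 0)) (x (firstRowBox h 1))) * hk''

theorem degProj_evalRow (h : two ≤ lam) (d : ℤ) (z : TPow K E (Box lam ⊥)) :
    degProj K E _ (d - 1) (evalRow K E h z) = evalRow K E h (degProj K E _ d z) := by
  refine degProj_comp (fun S x hx => ?_) z
  rw [evalRow_tprod h hx, map_smul, map_smul, degProj_tprod hx.restrict]
  rcases evalPairing_eq_zero_or h hx with h0 | h0
  · rw [h0]; simp
  · have hS : (S.card : ℤ) = (restrictSet S).card + 1 := by
      rcases h0 with h0 | h0 <;> conv_lhs => rw [h0]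
      · rw [Finset.card_insert_of_notMem (firstRowBox_notMem_map h _ _), Finset.card_map]; simp
      · rw [Finset.card_insert_of_notMem (firstRowBox_notMem_map h _ _), Finset.card_map]; simp
    rw [hS]
    simp only [eq_sub_iff_add_eq]
    split_ifs <;> simp

/-- The source of the sign twist when `X` acts on an uncontracted factor `c`. If the odd contracted
factor precedes `c`, then `X` passes it. Otherwise it is on `(0, 1)` and `c` lies before it, so
changing the parity at `c` flips `rowSign`. Either way exactly one sign appears. -/
theorem rowSign_symmDiff_incl (h : two ≤ lam) (S : Finset (Box lam ⊥)) (c : Box lam two)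
    (hS : S = insert (firstRowBox h 0) ((restrictSet S).map inclEmb) ∨
      S = insert (firstRowBox h 1) ((restrictSet S).map inclEmb)) :
    rowSign h (symmDiff S {c.incl}) * (∏ b ∈ S, if b < c.incl then (-1 : ℤ) else 1) =
      - (rowSign h S * ∏ b ∈ restrictSet S, if b < c then (-1 : ℤ) else 1) := by
  have hm : firstRowBox h 1 ∈ symmDiff S {c.incl} ↔ firstRowBox h 1 ∈ S := by
    simp [Finset.mem_symmDiff, incl_ne_firstRowBox h c 1]
  rw [rowSign, if_congr hm rfl rfl, prod_symmDiff_singleton _ _ _ (by split_ifs <;> simp)]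
  rcases hS with hS | hS
  · have h1 : firstRowBox h 1 ∉ S := by
      rw [hS]; exact firstRowBox_one_notMem h _
    rw [if_neg h1, rowSign, if_neg h1]
    conv_lhs => rw [hS]
    rw [Finset.prod_insert (firstRowBox_notMem_map h _ _), Finset.prod_map,
      if_pos (firstRowBox_lt_incl h c)]
    simp [Box.incl_lt]
  · have h1 : firstRowBox h 1 ∈ S := by
      rw [hS]; exact Finset.mem_insert_self _ _
    rw [if_pos h1, rowSign, if_pos h1]
    have e : (∏ b ∈ S, if b < c.incl then (-1 : ℤ) else 1) =
        (if firstRowBox h 1 < c.incl then -1 else 1) *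
          ∏ b ∈ restrictSet S, if b < c then (-1 : ℤ) else 1 := by
      conv_lhs => rw [hS]
      rw [Finset.prod_insert (firstRowBox_notMem_map h _ _), Finset.prod_map]
      simp [Box.incl_lt]
    rw [e]
    rcases lt_or_gt_of_ne (incl_ne_firstRowBox h c 1) with hlt | hlt
    · simp [hlt, hlt.not_gt]
    · simp [hlt, hlt.not_gt, firstRowBox_lt_incl]

/-- The action of an odd `X` on the two contracted factors contributes nothing. Signs from the odd
factors strictly between the two boxes occur both in `rowSign` and in moving `X`; once these are
accounted for, the claim is the invariance of the pairing on `V ⊗ V`. -/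
theorem evalPairing_oddPart_sign (h : two ≤ lam) {X : Vec K E →ₗ[K] Vec K E}
    (hX : X ∈ periplectic K E) {S : Finset (Box lam ⊥)} {x : Box lam ⊥ → Vec K E}
    (hx : IsHomog S x) :
    (rowSign h (symmDiff S {firstRowBox h 0}) : K) *
        evalPairing (oddPart X (x (firstRowBox h 0))) (x (firstRowBox h 1)) +
      ((∏ c ∈ S, if c < firstRowBox h 1 then -1 else 1 : ℤ) : K) *
        ((rowSign h (symmDiff S {firstRowBox h 1}) : K) *
          evalPairing (x (firstRowBox h 0)) (oddPart X (x (firstRowBox h 1)))) = 0 := by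
  have hne := firstRowBox_ne h
  have hm0 : firstRowBox h 1 ∈ symmDiff S {firstRowBox h 0} ↔ firstRowBox h 1 ∈ S := by
    simp [Finset.mem_symmDiff, hne.symm]
  have hm1 : firstRowBox h 1 ∈ symmDiff S {firstRowBox h 1} ↔ firstRowBox h 1 ∉ S := by
    simp [Finset.mem_symmDiff]
  have hlt := firstRowBox_lt h
  have hmin : ∀ c, c ≠ firstRowBox h 0 → firstRowBox h 0 < c := by
    intro c hc
    rcases eq_firstRowBox_or h c with rfl | rfl | ⟨c, rfl⟩
    · exact absurd rfl hc
    · exact hlt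
    · exact firstRowBox_lt_incl h c
  rw [rowSign, rowSign, if_congr hm0 rfl rfl, if_congr hm1 rfl rfl,
    prod_symmDiff_singleton _ _ _ (by split_ifs <;> simp),
    prod_symmDiff_singleton _ _ _ (by split_ifs <;> simp)]
  have hτ : (∏ c ∈ S, if c < firstRowBox h 1 then (-1 : ℤ) else 1) =
      (if firstRowBox h 0 ∈ S then -1 else 1) *
        ∏ c ∈ S, if firstRowBox h 0 < c ∧ c < firstRowBox h 1 then (-1 : ℤ) else 1 := by
    have h1 : (if firstRowBox h 0 ∈ S then (-1 : ℤ) else 1) =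
        ∏ c ∈ S, if c = firstRowBox h 0 then (-1 : ℤ) else 1 := by
      rw [Finset.prod_ite_eq']
    rw [h1, ← Finset.prod_mul_distrib]
    refine Finset.prod_congr rfl fun c _ => ?_
    by_cases hc : c = firstRowBox h 0
    · subst hc; simp [hlt]
    · simp [hc, hmin c hc]
  rw [hτ]
  have s1 := prod_sign_mul_self (p := fun c => firstRowBox h 0 < c ∧ c < firstRowBox h 1) S
  generalize (∏ c ∈ S, if firstRowBox h 0 < c ∧ c < firstRowBox h 1 then (-1 : ℤ) else 1) = n at *
  have s2 := congrArg (Int.cast (R := K)) s1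
  rw [Int.cast_mul, Int.cast_one] at s2
  have h0 := hx (firstRowBox h 0)
  have h1 := hx (firstRowBox h 1)
  have hodd (p : Bool) (v : Vec K E) (hv : proj K E p v = v) :
      proj K E (!p) (oddPart X v) = oddPart X v := by
    have := oddPart_proj X p v
    rwa [hv] at this
  -- For factors of different parities, applying `X` to either one makes the parities equal, and
  -- both pairings vanish.
  by_cases c0 : firstRowBox h 0 ∈ S <;> by_cases c1 : firstRowBox h 1 ∈ S <;>
    simp only [c0, c1, decide_true, decide_false] at h0 h1
  · have := evalPairing_oddPart_odd hX h0 h1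
    simp [c0, c1, this]
  · rw [evalPairing_eq_zero (hodd _ _ h0) h1, evalPairing_eq_zero h0 (hodd _ _ h1)]
    simp
  · rw [evalPairing_eq_zero (hodd _ _ h0) h1, evalPairing_eq_zero h0 (hodd _ _ h1)]
    simp
  · have := evalPairing_oddPart_even hX h0 h1
    simp only [c0, c1, if_false, if_true, lt_irrefl, and_false, not_false_eq_true, one_mul,
      Int.cast_one]
    linear_combination this + (evalPairing (x (firstRowBox h 0))
      (oddPart X (x (firstRowBox h 1)))) * s2

theorem IsHomog.update_oddPart {B : Type*} [Fintype B] [LinearOrder B] {S : Finset B}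
    {x : B → Vec K E} (hx : IsHomog S x) (X : Vec K E →ₗ[K] Vec K E) (b : B) :
    IsHomog (symmDiff S {b}) (Function.update x b (oddPart X (x b))) := by
  refine hx.update b (fun c hc => by simp [Finset.mem_symmDiff, hc]) ?_
  have h := oddPart_proj X (decide (b ∈ S)) (x b)
  rw [hx b] at h
  by_cases hb : b ∈ S <;> simpa [Finset.mem_symmDiff, hb] using h

theorem IsHomog.update_evenPart {B : Type*} [Fintype B] [LinearOrder B] {S : Finset B}
    {x : B → Vec K E} (hx : IsHomog S x) (X : Vec K E →ₗ[K] Vec K E) (b : B) :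
    IsHomog S (Function.update x b (evenPart X (x b))) := by
  refine hx.update b (fun c hc => Iff.rfl) ?_
  have h := evenPart_proj X (decide (b ∈ S)) (x b)
  rwa [hx b] at h

theorem update_comp_incl (x : Box lam ⊥ → Vec K E) (c : Box lam two) (v : Vec K E) :
    (fun b : Box lam two => Function.update x c.incl v b.incl) =
      Function.update (fun b : Box lam two => x b.incl) c v :=
  Function.update_comp_eq_of_injective x Box.incl_injective c v

/-- No symmetry of `z` along the rows is needed, because the pairing is invariant before
symmetrization. The terms at the two contracted boxes cancel and the others give the twisted action.
-/
theorem evalRow_tensorAct (h : two ≤ lam) {X : Vec K E →ₗ[K] Vec K E} (hX : X ∈ periplectic K E)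
    (z : TPow K E (Box lam ⊥)) :
    evalRow K E h (tensorAct X z) = tensorAct (signTwist X) (evalRow K E h z) := by
  refine LinearMap.congr_fun (f := evalRow K E h ∘ₗ tensorAct X)
    (g := tensorAct (signTwist X) ∘ₗ evalRow K E h) (ext_homog ?_) z
  intro S x hx
  have hne := firstRowBox_ne h
  have hsum := fun f : Box lam ⊥ → TPow K E (Box lam two) => sum_box hne
    (eq_firstRowBox_or h) (fun c => incl_ne_firstRowBox h c 0)
    (fun c => incl_ne_firstRowBox h c 1) f
  have u0 (v : Vec K E) : (fun c : Box lam two => Function.update x (firstRowBox h 0) v c.incl) =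
      fun c => x c.incl := by
    funext c; rw [Function.update_of_ne (incl_ne_firstRowBox h c 0).symm]
  have u1 (v : Vec K E) : (fun c : Box lam two => Function.update x (firstRowBox h 1) v c.incl) =
      fun c => x c.incl := by
    funext c; rw [Function.update_of_ne (incl_ne_firstRowBox h c 1).symm]
  have heven : evalRow K E h (tensorDer LinearMap.id (evenPart X) (PiTensorProduct.tprod K x)) =
      tensorDer LinearMap.id (evenPart X) (evalRow K E h (PiTensorProduct.tprod K x)) := by
    rw [tensorDer_even_tprod X hx, map_sum, evalRow_tprod h hx, map_smul, map_smul,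
      tensorDer_even_tprod X hx.restrict]
    simp only [evalRow_tprod h (hx.update_evenPart X _)]
    rw [hsum]
    simp only [Function.update_self, Function.update_of_ne hne, Function.update_of_ne hne.symm,
      u0, u1, update_comp_incl, Function.update_of_ne (incl_ne_firstRowBox h _ _)]
    rw [← add_assoc, ← smul_add, ← add_smul, evalPairing_evenPart hX, zero_smul, smul_zero,
      zero_add, Finset.smul_sum, Finset.smul_sum]
  have hodd : evalRow K E h
        (tensorDer (parityInv K E) (oddPart X) (PiTensorProduct.tprod K x)) =
      (-1 : K) • tensorDer (parityInv K E) (oddPart X)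
        (evalRow K E h (PiTensorProduct.tprod K x)) := by
    have hτ0 : (∏ c ∈ S, if c < firstRowBox h 0 then (-1 : ℤ) else 1) = 1 := by
      refine Finset.prod_eq_one fun c _ => if_neg ?_
      rcases eq_firstRowBox_or h c with rfl | rfl | ⟨c, rfl⟩
      · exact lt_irrefl _
      · exact (firstRowBox_lt h).not_gt
      · exact (firstRowBox_lt_incl h c).not_gt
    rw [tensorDer_odd_tprod X hx, map_sum, evalRow_tprod h hx, map_smul, map_smul,
      tensorDer_odd_tprod X hx.restrict]
    simp only [map_smul, evalRow_tprod h (hx.update_oddPart X _)]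
    rw [hsum]
    simp only [Function.update_self, Function.update_of_ne hne, Function.update_of_ne hne.symm,
      u0, u1, update_comp_incl, Function.update_of_ne (incl_ne_firstRowBox h _ _)]
    rw [← add_assoc, hτ0, Int.cast_one, one_smul]
    simp only [smul_smul]
    rw [← add_smul, evalPairing_oddPart_sign h hX hx, zero_smul, zero_add,
      Finset.smul_sum]
    refine Finset.sum_congr rfl fun c _ => ?_
    rw [smul_smul]
    congr 1
    rcases evalPairing_eq_zero_or h hx with h0 | h0
    · rw [h0]; simp
    · have hs := congrArg (Int.cast (R := K)) (rowSign_symmDiff_incl h S c h0)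
      rw [Int.cast_mul, Int.cast_neg, Int.cast_mul] at hs
      linear_combination (evalPairing (x (firstRowBox h 0)) (x (firstRowBox h 1))) * hs
  rw [LinearMap.comp_apply, LinearMap.comp_apply, tensorAct_signTwist, tensorAct,
    LinearMap.add_apply, LinearMap.add_apply, LinearMap.smul_apply, map_add, heven, hodd]

end EvalRow

/-! ### Coordinates of Schur maps on basis tensors. -/

section Labels

variable {K E : Type*} [Field K] [AddCommGroup E] [Module K E]
variable {ι : Type*} [DecidableEq ι] (b : Module.Basis ι K E)

/-- The basis vectors of `V`: those of `E`, and those of the dual basis of `E*`. -/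
noncomputable def basisVec : ι ⊕ ι → Vec K E
  | Sum.inl i => (b i, 0)
  | Sum.inr i => (0, b.coord i)

/-- The coordinates of a vector of `V` in the basis `basisVec`. -/
noncomputable def basisCoord : ι ⊕ ι → (Vec K E →ₗ[K] K)
  | Sum.inl i => b.coord i ∘ₗ LinearMap.fst K E (Module.Dual K E)
  | Sum.inr i => Module.Dual.eval K E (b i) ∘ₗ LinearMap.snd K E (Module.Dual K E)

theorem basisCoord_basisVec (l m : ι ⊕ ι) :
    basisCoord b l (basisVec b m) = if l = m then 1 else 0 := by
  rcases l with i | i <;> rcases m with j | j <;>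
    simp [basisCoord, basisVec, Finsupp.single_apply, eq_comm]

theorem evalPairing_basisVec (l m : ι ⊕ ι) :
    evalPairing (basisVec b l) (basisVec b m) = if l = m.swap then 1 else 0 := by
  rcases l with i | i <;> rcases m with j | j <;>
    simp [evalPairing, basisVec, Finsupp.single_apply, eq_comm]

variable {B : Type*} [Fintype B] [LinearOrder B]

/-- The coordinate of a tensor at the pure tensor of basis vectors with labels `t`. -/
noncomputable def tensorCoord (t : B → ι ⊕ ι) : TPow K E B →ₗ[K] K :=
  PiTensorProduct.lift ((MultilinearMap.mkPiAlgebra K B K).compLinearMap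
    fun c => basisCoord b (t c))

theorem tensorCoord_tprod (t x : B → ι ⊕ ι) :
    tensorCoord b t (PiTensorProduct.tprod K fun c => basisVec b (x c)) =
      if t = x then 1 else 0 := by
  rw [tensorCoord, PiTensorProduct.lift.tprod]
  simp only [MultilinearMap.compLinearMap_apply, MultilinearMap.mkPiAlgebra_apply,
    basisCoord_basisVec]
  rw [Finset.prod_ite_zero]
  simp [funext_iff]

/-- The positions of the odd labels. -/
def oddSet (x : B → ι ⊕ ι) : Finset B := Finset.univ.filter fun c => (x c).isRight

theorem isHomog_basisVec (x : B → ι ⊕ ι) : IsHomog (oddSet x) fun c => basisVec b (x c) := by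
  intro c
  rcases hx : x c with i | i
  · simpa [oddSet, hx, basisVec] using proj_false_mk (b i)
  · simpa [oddSet, hx, basisVec] using proj_true_mk (b.coord i)

theorem signedPerm_basisVec (σ : Equiv.Perm B) {x : B → ι ⊕ ι} (hx : (oddSet x).card ≤ 1) :
    signedPerm K E σ (PiTensorProduct.tprod K fun c => basisVec b (x c)) =
      PiTensorProduct.tprod K fun c => basisVec b (x (σ.symm c)) := by
  rw [signedPerm_tprod σ (isHomog_basisVec b x), koszulSign_of_card_le_one σ hx, Int.cast_one,
    one_smul]

theorem oddSet_perm (σ : Equiv.Perm B) (x : B → ι ⊕ ι) :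
    oddSet (fun c => x (σ.symm c)) = (oddSet x).map σ.toEmbedding := by
  ext c
  simp [oddSet, Finset.mem_map_equiv]

variable {lam mu : YoungDiagram}

theorem schurMap_basisVec {x : Box lam mu → ι ⊕ ι} (hx : (oddSet x).card ≤ 1) :
    schurMap K E lam mu (PiTensorProduct.tprod K fun c => basisVec b (x c)) =
      ∑ p : Equiv.Perm (Box lam mu) with ∀ c, (p c).row = c.row,
        ∑ q : Equiv.Perm (Box lam mu) with ∀ c, (q c).col = c.col,
          ((Equiv.Perm.sign q : ℤ) : K) •
            PiTensorProduct.tprod K fun c => basisVec b (x ((p * q).symm c)) := by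
  simp only [schurMap, rowSym, colAlt, LinearMap.comp_apply, LinearMap.sum_apply,
    LinearMap.smul_apply, map_sum, map_smul, signedPerm_basisVec b _ hx]
  rw [Finset.sum_comm]
  refine Finset.sum_congr rfl fun q _ => ?_
  rw [Finset.smul_sum]
  refine Finset.sum_congr rfl fun p _ => ?_
  have hx' : (oddSet fun c => x (q.symm c)).card ≤ 1 := by rwa [oddSet_perm, Finset.card_map]
  rw [signedPerm_basisVec b p hx']
  rfl

/-- A functional on a Schur complex, computed on the image of a basis tensor of degree at most one,
in the case where only one permutation of the columns contributes. -/
theorem apply_schurMap_basisVec_ne_zero [CharZero K] {x : Box lam mu → ι ⊕ ι}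
    (hx : (oddSet x).card ≤ 1) (Ψ : TPow K E (Box lam mu) →ₗ[K] K)
    {P : Equiv.Perm (Box lam mu) → Prop} [DecidablePred P]
    (hP : ∀ σ, Ψ (PiTensorProduct.tprod K fun c => basisVec b (x (σ.symm c))) =
      if P σ then 1 else 0) {q₀ : Equiv.Perm (Box lam mu)} (hq₀ : ∀ c, (q₀ c).col = c.col)
    (hq : ∀ p q : Equiv.Perm (Box lam mu), (∀ c, (p c).row = c.row) → (∀ c, (q c).col = c.col) →
      P (p * q) → q = q₀) (h1 : P q₀) :
    Ψ (schurMap K E lam mu (PiTensorProduct.tprod K fun c => basisVec b (x c))) ≠ 0 := by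
  -- With at most one odd factor there are no Koszul signs, so only the column permutation carries a
  -- sign. Once it is forced to be `q₀`, all contributions have the same sign and are merely
  -- counted; `p = 1` is one of them.
  have h2 : Ψ (schurMap K E lam mu (PiTensorProduct.tprod K fun c => basisVec b (x c))) =
      ((Equiv.Perm.sign q₀ : ℤ) : K) * ((Finset.univ.filter fun p : Equiv.Perm (Box lam mu) =>
        (∀ c, (p c).row = c.row) ∧ P (p * q₀)).card : K) := by
    rw [schurMap_basisVec b hx, map_sum, Finset.card_filter, Nat.cast_sum, Finset.mul_sum,
      Finset.sum_filter]
    refine Finset.sum_congr rfl fun p _ => ?_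
    by_cases hp : ∀ c, (p c).row = c.row
    · rw [if_pos hp, map_sum, Finset.sum_eq_single q₀]
      · rw [map_smul, hP]; simp [hp]
      · intro q hq1 hne
        rw [map_smul, hP, if_neg, smul_zero]
        exact fun h => hne (hq p q hp (Finset.mem_filter.1 hq1).2 h)
      · intro h
        exact absurd (Finset.mem_filter.2 ⟨Finset.mem_univ _, hq₀⟩) h
    · rw [if_neg hp, if_neg fun h => hp h.1]; simp
  rw [h2]
  refine mul_ne_zero ?_ (Nat.cast_ne_zero.2 (Finset.card_ne_zero.2 ⟨1, ?_⟩))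
  · rcases Int.units_eq_one_or (Equiv.Perm.sign q₀) with h | h <;> simp [h]
  · simp [h1]

/-- A filling that increases with slope one down the columns is fixed by no product of a row
permutation and a nontrivial column permutation. -/
theorem eq_one_of_comp_eq {f : Box lam mu → ℤ} {h : ℕ → ℤ}
    (hf : ∀ c, f c = c.row + h c.col) {p q : Equiv.Perm (Box lam mu)}
    (hp : ∀ c, (p c).row = c.row) (hq : ∀ c, (q c).col = c.col)
    (hpq : ∀ c, f ((p * q) c) = f c) : q = 1 := by
  have hq' : ∀ c, (q.symm c).col = c.col := fun c => by rw [← hq (q.symm c)]; simp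
  have h1 : ∀ c, f (p c) = (q.symm c).row + h c.col := fun c => by
    have := hpq (q.symm c)
    rw [Equiv.Perm.mul_apply, Equiv.apply_symm_apply] at this
    rw [this, hf, hq']
  -- Pair with the row function, which `p` preserves. The terms in `h` cancel because `q` preserves
  -- columns, so the row function and its composite with `q⁻¹` have inner product equal to their
  -- common square norm. They coincide, as in the equality case of Cauchy–Schwarz.
  have h2 : ∑ c : Box lam mu, (c.row : ℤ) * f (p c) = ∑ c : Box lam mu, (c.row : ℤ) * f c := by
    rw [← Equiv.sum_comp p fun c => (c.row : ℤ) * f c]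
    simp only [hp]
  simp only [h1, hf, mul_add, Finset.sum_add_distrib] at h2
  have h3 : ∑ c, ((q.symm c).row : ℤ) * (q.symm c).row =
      ∑ c : Box lam mu, (c.row : ℤ) * c.row :=
    Equiv.sum_comp q.symm fun c => (c.row : ℤ) * c.row
  have h4 : ∑ c : Box lam mu, ((c.row : ℤ) - (q.symm c).row) ^ 2 = 0 := by
    have : ∀ c : Box lam mu, ((c.row : ℤ) - (q.symm c).row) ^ 2 =
      (c.row : ℤ) * c.row - 2 * (c.row * (q.symm c).row) + (q.symm c).row * (q.symm c).row :=
      fun c => by ring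
    simp only [this, Finset.sum_add_distrib, Finset.sum_sub_distrib, ← Finset.mul_sum]
    linarith
  rw [Finset.sum_eq_zero_iff_of_nonneg fun c _ => sq_nonneg _] at h4
  have h5 : q.symm = 1 := by
    ext1 c
    have := h4 c (Finset.mem_univ _)
    have hr : (c.row : ℤ) = (q.symm c).row := by nlinarith [sq_eq_zero_iff.1 this]
    exact Box.ext (by exact_mod_cast hr.symm) (hq' c)
  ext1 c
  have := congrArg (fun σ => σ (q c)) h5
  simpa using this.symm

end Labels

/-! ### Explicit tensors with nonzero image. -/

section NonZero

variable {K E : Type*} [Field K] [CharZero K] [AddCommGroup E] [Module K E]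
  [FiniteDimensional K E] {lam : YoungDiagram}

theorem Box.mem_lam {mu : YoungDiagram} (c : Box lam mu) : (c.row, c.col) ∈ lam :=
  (YoungDiagram.mem_cells _).1 (Finset.mem_sdiff.1 c.mem).1

theorem Box.row_lt_colLen {mu : YoungDiagram} (c : Box lam mu) : c.row < lam.colLen c.col :=
  YoungDiagram.mem_iff_lt_colLen.1 c.mem_lam

theorem Box.row_lt_of_col_ne_zero {mu : YoungDiagram} {n : ℕ} (hn : lam.colLen 1 ≤ n)
    (c : Box lam mu) (hc : c.col ≠ 0) : c.row < n :=
  c.row_lt_colLen.trans_le ((lam.colLen_anti 1 c.col (Nat.one_le_iff_ne_zero.2 hc)).trans hn)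

/-- The coordinate is taken at the filling `t` with `e_row` on every box, except for `e₀*` at the
bottom of the first column. That exception lets the first column have `dim E + 1` boxes. The summand
`e₀ ⊗ e₀*` of the trace gives `t` up to exchanging `(1, 0)` with the bottom box, and no other
summand contains `e₀*`. -/
theorem insertTrace_nonzero (h : oneOne ≤ lam) (h0 : lam.colLen 0 ≤ Module.finrank K E + 1)
    (h1 : lam.colLen 1 ≤ Module.finrank K E) :
    ∃ z ∈ tensorPart K E (Box lam oneOne) 0,
      schurMap K E lam ⊥ (insertTrace K E lam z) ≠ 0 := by
  set n := Module.finrank K E with hn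
  set b := Module.finBasis K E
  set a := lam.colLen 0 with ha
  have ha2 : 2 ≤ a := (firstColBox h 1).row_lt_colLen
  have hn0 : 0 < n := by lia
  -- The default value plays no role: all boxes other than `last` lie in rows below `n`, and `lab 1`
  -- is used only when the first column has at least three boxes, so that `1 < n`.
  let lab : ℕ → Fin n := fun i => if hi : i < n then ⟨i, hi⟩ else ⟨0, hn0⟩
  have hlab : ∀ i < n, (lab i : ℕ) = i := fun i hi => by simp [lab, hi]
  let last : Box lam ⊥ := ⟨a - 1, 0, by
    simp only [YoungDiagram.cells_bot, Finset.sdiff_empty, YoungDiagram.mem_cells,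
      YoungDiagram.mem_iff_lt_colLen]
    lia⟩
  let t : Box lam ⊥ → Fin n ⊕ Fin n := fun c => if c = last then Sum.inr (lab 0)
    else Sum.inl (lab c.row)
  let s : Equiv.Perm (Box lam ⊥) := Equiv.swap (firstColBox h 1) last
  -- The bottom box receives the label that `t` has on `(1, 0)`. If the column has only two boxes,
  -- `last` is itself removed and this case does not occur.
  let z : Box lam oneOne → Fin n ⊕ Fin n := fun c => if c.incl = last then Sum.inl (lab 1)
    else Sum.inl (lab c.row)
  have hcol : ∀ c, (s c).col = c.col := fun c =>
    (swap_mem_stabilizer (r := Box.col) (F := ∅) (b := firstColBox h 1) (c := last) rfl (by simp)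
      (by simp)).1 c
  have hz : oddSet z = ∅ := by
    refine Finset.filter_false_of_mem fun c _ => ?_
    by_cases hc : c.incl = last <;> simp [z, hc]
  let x : Fin n → Box lam ⊥ → Fin n ⊕ Fin n := fun k c =>
    if c = firstColBox h 0 then Sum.inl k else if c = firstColBox h 1 then Sum.inr k
      else if c = last then Sum.inl (lab 1) else Sum.inl (lab c.row)
  have hT : insertTrace K E lam (PiTensorProduct.tprod K fun c => basisVec b (z c)) =
      ∑ k, PiTensorProduct.tprod K fun c => basisVec b (x k c) := by
    rw [insertTrace_apply]
    refine Finset.sum_congr rfl fun k _ => ?_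
    rw [insertPair_tprod]
    congr 1
    symm
    refine eq_fillPair h ?_ ?_ fun c => ?_
    · simp [x, basisVec, b]
    · simp [x, basisVec, (firstColBox_lt h).ne', b]
    · simp only [x, z, (firstColBox_ne_incl h 0 c).symm, (firstColBox_ne_incl h 1 c).symm, if_false]
      rfl
  have hx : ∀ k, oddSet (x k) = {firstColBox h 1} := by
    intro k
    ext c
    simp only [oddSet, Finset.mem_filter, Finset.mem_univ, true_and, Finset.mem_singleton, x]
    by_cases c0 : c = firstColBox h 0
    · simp [c0, (firstColBox_lt h).ne]
    · by_cases c1 : c = firstColBox h 1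
      · simp [c1, (firstColBox_lt h).ne']
      · simp only [c0, c1, if_false, iff_false]
        split_ifs <;> simp
  have hx0 : x (lab 0) = fun c => t (s c) := by
    funext c
    have e0 : firstColBox h 0 ≠ last := fun he => by
      have : (0 : ℕ) = a - 1 := congrArg Box.row he
      lia
    by_cases c0 : c = firstColBox h 0
    · subst c0
      have : s (firstColBox h 0) = firstColBox h 0 :=
        Equiv.swap_apply_of_ne_of_ne (firstColBox_lt h).ne e0
      simp only [this, x, t, if_true, e0, if_false]
      rfl
    · by_cases c1 : c = firstColBox h 1
      · subst c1
        simp [x, t, s, (firstColBox_lt h).ne']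
      · by_cases c2 : c = last
        · have : s c = firstColBox h 1 := by rw [c2]; exact Equiv.swap_apply_right _ _
          have c3 : firstColBox h 1 ≠ last := fun he => c1 (c2.trans he.symm)
          simp only [this, x, t, c0, c1, if_false, c3]
          rw [if_pos c2]
          rfl
        · have : s c = c := Equiv.swap_apply_of_ne_of_ne c1 c2
          simp [this, x, t, c0, c1, c2]
  -- Dual labels are given the row of the bottom box, so that `ψ ∘ t` is exactly the row function.
  -- Injectivity of `ψ` is not required.
  let ψ : Fin n ⊕ Fin n → ℤ := Sum.elim (fun i => (i : ℤ)) fun _ => a - 1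
  have hψ : ∀ c, ψ (t c) = c.row + (fun _ => 0 : ℕ → ℤ) c.col := by
    intro c
    by_cases hc : c = last
    · simp [t, hc, ψ, last]; lia
    · have : c.row < n := by
        by_cases hc0 : c.col = 0
        · have h3 := c.row_lt_colLen
          rw [hc0] at h3
          have h4 : c.row ≠ a - 1 := fun h4 => hc (Box.ext h4 hc0)
          lia
        · exact c.row_lt_of_col_ne_zero h1 hc0
      simp [t, hc, ψ, hlab _ this]
  refine ⟨PiTensorProduct.tprod K fun c => basisVec b (z c), ?_, fun hzero => ?_⟩
  · have := tprod_mem_tensorPart (isHomog_basisVec b z)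
    rwa [hz] at this
  rw [hT, map_sum] at hzero
  have hΨ := congrArg (tensorCoord b t) hzero
  rw [map_zero, map_sum, Finset.sum_eq_single (lab 0)] at hΨ
  · refine apply_schurMap_basisVec_ne_zero b (x := x (lab 0)) (by rw [hx]; simp) (tensorCoord b t)
      (P := fun σ => t = fun c => x (lab 0) (σ.symm c))
      (fun σ => tensorCoord_tprod b t _) (q₀ := s) hcol ?_ ?_ hΨ
    · intro p q hp hq hP
      -- Absorbing `s` into the column permutation reduces to fillings that fix `t`, so the only
      -- contributing `q` is the inverse of `s`, which is `s`.
      have hPt : ∀ c, t ((p * (q * s)) c) = t c := by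
        intro c
        have := congrFun hP ((p * q) (s c))
        rw [Equiv.symm_apply_apply, hx0] at this
        rw [← mul_assoc, Equiv.Perm.mul_apply, this]
        simp [s]
      have := eq_one_of_comp_eq (f := fun c => ψ (t c)) (h := fun _ => 0) hψ hp (q := q * s) (fun c => by simp [hq, hcol])
        fun c => congrArg ψ (hPt c)
      rw [mul_eq_one_iff_eq_inv] at this
      rw [this, Equiv.swap_inv]
    · funext c
      rw [hx0]
      simp
  · intro k _ hk
    rw [schurMap_basisVec b (by rw [hx]; simp)]
    simp only [map_sum, map_smul]
    refine Finset.sum_eq_zero fun p _ => Finset.sum_eq_zero fun q _ => ?_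
    rw [tensorCoord_tprod, if_neg, smul_zero]
    intro ht
    have h2 := congrFun ht last
    simp only [t, if_true, x] at h2
    split_ifs at h2
    exact hk (Sum.inr_injective h2).symm
  · simp

/-- The filling has `e_row` outside the first column, and `e₀*, e₀, e₁, …` down the first column, so
`n + 1` boxes fit there. The boxes `(0, 0)` and `(0, 1)` carry the dual pair `e₀*`, `e₀`, and the
coordinate is read at the remaining labels after contracting them. -/
theorem evalRow_nonzero (h : two ≤ lam) (h0 : lam.colLen 0 ≤ Module.finrank K E + 1)
    (h1 : lam.colLen 1 ≤ Module.finrank K E) :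
    ∃ z ∈ tensorPart K E (Box lam ⊥) 1, evalRow K E h (schurMap K E lam ⊥ z) ≠ 0 := by
  set n := Module.finrank K E with hn
  set b := Module.finBasis K E
  have hn0 : 0 < n := (Nat.zero_le _).trans_lt ((firstRowBox h 1).row_lt_of_col_ne_zero h1
    (by simp [firstRowBox]))
  let lab : ℕ → Fin n := fun i => if hi : i < n then ⟨i, hi⟩ else ⟨0, hn0⟩
  have hlab : ∀ i < n, (lab i : ℕ) = i := fun i hi => by simp [lab, hi]
  let w : Box lam ⊥ → Fin n ⊕ Fin n := fun c => if c = firstRowBox h 0 then Sum.inr (lab 0)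
    else if c.col = 0 then Sum.inl (lab (c.row - 1)) else Sum.inl (lab c.row)
  have hw0 : w (firstRowBox h 0) = Sum.inr (lab 0) := by simp [w]
  have hw1 : w (firstRowBox h 1) = Sum.inl (lab 0) := by
    simp [w, (firstRowBox_ne h).symm]
    simp [firstRowBox]
  have hodd : ∀ c k, w c = Sum.inr k → c = firstRowBox h 0 := by
    intro c k hc
    by_contra hne
    by_cases h2 : c.col = 0 <;> simp [w, hne, h2] at hc
  have hw : oddSet w = {firstRowBox h 0} := by
    ext c
    simp only [oddSet, Finset.mem_filter, Finset.mem_univ, true_and, Finset.mem_singleton]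
    constructor
    · intro hc
      obtain ⟨k, hk⟩ := Sum.isRight_iff.1 hc
      exact hodd c k hk
    · rintro rfl
      simp [hw0]
  -- The value `-1` continues the labels of the first column upwards, giving slope one with offset
  -- `-1` there and `0` elsewhere.
  let ψ : Fin n ⊕ Fin n → ℤ := Sum.elim (fun i => (i : ℤ)) fun _ => -1
  have hψ : ∀ c, ψ (w c) = c.row + (fun j => if j = 0 then -1 else 0 : ℕ → ℤ) c.col := by
    intro c
    by_cases hc : c = firstRowBox h 0
    · subst hc
      rw [hw0]
      simp [ψ, firstRowBox]
    · by_cases hc0 : c.col = 0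
      · have hr : c.row ≠ 0 := fun hr => hc (Box.ext hr hc0)
        have h3 := c.row_lt_colLen
        rw [hc0] at h3
        have h4 : c.row - 1 < n := by lia
        simp [w, hc, hc0, ψ, hlab _ h4]
        lia
      · simp [w, hc, hc0, ψ, hlab _ (c.row_lt_of_col_ne_zero h1 hc0)]
  -- The pairing is symmetric, so the coordinate cannot distinguish `w` from `w ∘ s`. Since `s`
  -- preserves rows, this ambiguity is absorbed into the row permutation.
  let s : Equiv.Perm (Box lam ⊥) := Equiv.swap (firstRowBox h 0) (firstRowBox h 1)
  have hrow : ∀ c, (s c).row = c.row := fun c =>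
    (swap_mem_stabilizer (r := Box.row) (F := ∅) (b := firstRowBox h 0) (c := firstRowBox h 1) rfl
      (by simp) (by simp)).1 c
  let Ψ : TPow K E (Box lam ⊥) →ₗ[K] K :=
    tensorCoord b (fun c : Box lam two => w c.incl) ∘ₗ evalRow K E h
  let P : Equiv.Perm (Box lam ⊥) → Prop := fun σ =>
    (∀ c : Box lam two, w c.incl = w (σ.symm c.incl)) ∧
      w (σ.symm (firstRowBox h 0)) = (w (σ.symm (firstRowBox h 1))).swap
  refine ⟨PiTensorProduct.tprod K fun c => basisVec b (w c), ?_, fun hzero => ?_⟩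
  · have := tprod_mem_tensorPart (isHomog_basisVec b w)
    rwa [hw] at this
  refine apply_schurMap_basisVec_ne_zero b (x := w) (by rw [hw]; simp) Ψ (P := P) ?_
    (q₀ := 1) (fun _ => rfl) ?_ ?_ (congrArg (tensorCoord b fun c : Box lam two => w c.incl) hzero
      |>.trans (map_zero _))
  · intro σ
    have hS : (oddSet fun c => w (σ.symm c)) = {σ (firstRowBox h 0)} := by
      rw [oddSet_perm, hw]; simp
    -- If the only odd factor is on `(0, 1)`, no odd factor lies strictly between the two contracted
    -- boxes.
    have hsign : rowSign h (oddSet fun c => w (σ.symm c)) = 1 := by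
      rw [hS, rowSign]
      split_ifs with hm
      · rw [Finset.prod_singleton, if_neg]
        rw [← Finset.mem_singleton.1 hm]
        exact fun h => h.2.false
      · rfl
    rw [LinearMap.comp_apply, evalRow_tprod h (isHomog_basisVec b _), hsign, Int.cast_one, one_smul,
      map_smul, tensorCoord_tprod b _ fun c : Box lam two => w (σ.symm c.incl),
      evalPairing_basisVec]
    by_cases hA : w (σ.symm (firstRowBox h 0)) = (w (σ.symm (firstRowBox h 1))).swap <;>
    by_cases hB : ∀ c : Box lam two, w c.incl = w (σ.symm c.incl) <;>
    simp [P, funext_iff, hA, hB]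
  · rintro p q hp hq ⟨hP1, hP2⟩
    set σ := p * q with hσ
    -- The two contracted labels are mutually dual, so one of them is the unique dual label `e₀*` of
    -- `w` and the other is `e₀`; all remaining labels are prescribed.
    have hfix : (∀ c, w (σ.symm c) = w c) ∨ ∀ c, w (σ.symm c) = w (s c) := by
      have hs0 : s (firstRowBox h 0) = firstRowBox h 1 := Equiv.swap_apply_left _ _
      have hs1 : s (firstRowBox h 1) = firstRowBox h 0 := Equiv.swap_apply_right _ _
      have hs2 : ∀ c : Box lam two, s c.incl = c.incl := fun c =>
        Equiv.swap_apply_of_ne_of_ne (incl_ne_firstRowBox h c 0).symm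
          (incl_ne_firstRowBox h c 1).symm
      rcases e0 : w (σ.symm (firstRowBox h 0)) with k | k
      · rcases e1 : w (σ.symm (firstRowBox h 1)) with l | l
        · rw [e0, e1] at hP2; simp at hP2
        · right
          have e2 := hodd _ _ e1
          have e3 : w (σ.symm (firstRowBox h 1)) = Sum.inr (lab 0) := by rw [e2, hw0]
          rw [e3] at hP2
          intro c
          rcases eq_firstRowBox_or h c with rfl | rfl | ⟨c, rfl⟩
          · rw [hP2, hs0, hw1]; rfl
          · rw [e3, hs1, hw0]
          · rw [hs2, hP1]
      · left
        have e2 := hodd _ _ e0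
        have e3 : w (σ.symm (firstRowBox h 0)) = Sum.inr (lab 0) := by rw [e2, hw0]
        rw [e3] at hP2
        intro c
        rcases eq_firstRowBox_or h c with rfl | rfl | ⟨c, rfl⟩
        · rw [e3, hw0]
        · rw [hw1, ← Sum.swap_swap (w _), ← hP2]; rfl
        · rw [hP1]
    rcases hfix with hfix | hfix
    · refine eq_one_of_comp_eq (f := fun c => ψ (w c)) (h := fun j => if j = 0 then -1 else 0) hψ hp hq fun c => congrArg ψ ?_
      rw [← hfix ((p * q) c), Equiv.symm_apply_apply]
    · refine eq_one_of_comp_eq (f := fun c => ψ (w c)) (h := fun j => if j = 0 then -1 else 0) hψ (p := s * p)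
        (fun c => by simp [hrow, hp]) hq fun c => congrArg ψ ?_
      rw [mul_assoc, Equiv.Perm.mul_apply, ← hfix ((p * q) c), Equiv.symm_apply_apply]
  · refine ⟨fun c => rfl, ?_⟩
    change w (firstRowBox h 0) = (w (firstRowBox h 1)).swap
    rw [hw0, hw1]; rfl

end NonZero

/-! ### Passage of the two maps to Schur complexes. -/

section Descent

variable {K E : Type*} [Field K] [CharZero K] [AddCommGroup E] [Module K E] {lam : YoungDiagram}

theorem Box.lam_of_mem {i j : ℕ} (h : (i, j) ∈ lam) :
    (i, j) ∈ lam.cells \ (⊥ : YoungDiagram).cells := by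
  simpa using h

/-- Freezing proceeds from the top of the column: `(0, 0)` first and then `(1, 0)`, so that each
frozen box is topmost among the boxes of its column not yet frozen, as the auxiliary box `d`
requires. -/
theorem exists_schurMap_eq_mul_col (h : oneOne ≤ lam) :
    ∃ u : Module.End K (TPow K E (Box lam ⊥)), schurMap K E lam ⊥ =
      u * (stabSum K (signedPermHom K E _) 1 Box.row {firstColBox h 1, firstColBox h 0} *
        stabSum K (signedPermHom K E _) Equiv.Perm.sign Box.col
          {firstColBox h 1, firstColBox h 0}) := by
  have hd (F : Finset (Box lam ⊥)) (x : Box lam ⊥) (hx : x.col = 0) (hF : ∀ c ∈ F, c.col = 0)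
      (hrow : ∀ c : Box lam ⊥, c.col = 0 → c ∉ F → c ≠ x → x.row ≤ c.row) :
      ∀ c : Box lam ⊥, c.col = x.col → c ∉ F → c ≠ x → ∀ b : Box lam ⊥, b.row = c.row → b ∉ F →
        b ≠ c → ∃ d : Box lam ⊥, d ∉ F ∧ d.row = x.row ∧ d.col = b.col ∧ d.col ≠ x.col ∧ d ≠ b := by
    intro c hc hcF hcx b hb hbF hbc
    rw [hx] at hc
    have hle := hrow c hc hcF hcx
    have hbcol : b.col ≠ 0 := fun h0 => hbc (Box.ext hb (h0.trans hc.symm))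
    -- The corner in the row of `x` and the column of `b` belongs to `lam` because it lies weakly
    -- above `b`.
    refine ⟨⟨x.row, b.col, Box.lam_of_mem (lam.up_left_mem (hle.trans hb.ge) le_rfl b.mem_lam)⟩,
      fun hm => by have := hF _ hm; exact hbcol this, rfl, rfl, by rwa [hx], fun he => ?_⟩
    have := congrArg Box.row he
    dsimp only at this
    exact hcx (Box.ext (by lia) (by lia))
  obtain ⟨u, hu⟩ := exists_stabSum_mul_stabSum (K := K) (ρ := signedPermHom K E (Box lam ⊥))
    (F := ∅) (x := firstColBox h 0) one_mul_sign_swap (by simp)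
    (hd ∅ (firstColBox h 0) rfl (by simp) fun c _ _ _ => Nat.zero_le _)
  obtain ⟨v, hv⟩ := exists_stabSum_mul_stabSum (K := K) (ρ := signedPermHom K E (Box lam ⊥))
    (F := {firstColBox h 0}) (x := firstColBox h 1) one_mul_sign_swap
    (by simpa using (firstColBox_lt h).ne')
    (hd {firstColBox h 0} (firstColBox h 1) rfl (by simp [firstColBox]) fun c hc hcF _ => by
      rw [Finset.mem_singleton] at hcF
      have : c.row ≠ 0 := fun h0 => hcF (Box.ext h0 hc)
      simp only [firstColBox, Fin.val_one]
      lia)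
  refine ⟨u * v, ?_⟩
  rw [schurMap_eq, hu, mul_assoc]
  exact congrArg (u * ·) hv

/-- The mirror image, freezing the first row from the left. The remaining factor stands on the right
because the evaluation is applied after the Schur map. -/
theorem exists_schurMap_eq_row_mul (h : two ≤ lam) :
    ∃ u : Module.End K (TPow K E (Box lam ⊥)), schurMap K E lam ⊥ =
      stabSum K (signedPermHom K E _) 1 Box.row {firstRowBox h 1, firstRowBox h 0} *
        stabSum K (signedPermHom K E _) Equiv.Perm.sign Box.col
          {firstRowBox h 1, firstRowBox h 0} * u := by
  have hd (F : Finset (Box lam ⊥)) (x : Box lam ⊥) (hx : x.row = 0) (hF : ∀ c ∈ F, c.row = 0)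
      (hcol : ∀ c : Box lam ⊥, c.row = 0 → c ∉ F → c ≠ x → x.col ≤ c.col) :
      ∀ c : Box lam ⊥, c.row = x.row → c ∉ F → c ≠ x → ∀ b : Box lam ⊥, b.col = c.col → b ∉ F →
        b ≠ c → ∃ d : Box lam ⊥, d ∉ F ∧ d.col = x.col ∧ d.row = b.row ∧ d.row ≠ x.row ∧ d ≠ b := by
    intro c hc hcF hcx b hb hbF hbc
    rw [hx] at hc
    have hle := hcol c hc hcF hcx
    have hbrow : b.row ≠ 0 := fun h0 => hbc (Box.ext (h0.trans hc.symm) hb)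
    refine ⟨⟨b.row, x.col, Box.lam_of_mem (lam.up_left_mem le_rfl (hle.trans hb.ge) b.mem_lam)⟩,
      fun hm => by have := hF _ hm; exact hbrow this, rfl, rfl, by rwa [hx], fun he => ?_⟩
    have := congrArg Box.col he
    dsimp only at this
    exact hcx (Box.ext (by lia) (by lia))
  obtain ⟨u, hu⟩ := exists_stabSum_mul_stabSum_right (K := K)
    (ρ := signedPermHom K E (Box lam ⊥)) (F := ∅) (x := firstRowBox h 0) one_mul_sign_swap (by simp)
    (hd ∅ (firstRowBox h 0) rfl (by simp) fun c _ _ _ => Nat.zero_le _)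
  obtain ⟨v, hv⟩ := exists_stabSum_mul_stabSum_right (K := K)
    (ρ := signedPermHom K E (Box lam ⊥)) (F := {firstRowBox h 0}) (x := firstRowBox h 1)
    one_mul_sign_swap (by simpa using (firstRowBox_ne h).symm)
    (hd {firstRowBox h 0} (firstRowBox h 1) rfl (by simp [firstRowBox]) fun c hc hcF _ => by
      rw [Finset.mem_singleton] at hcF
      have : c.col ≠ 0 := fun h0 => hcF (Box.ext hc h0)
      simp only [firstRowBox, Fin.val_one]
      lia)
  refine ⟨v * u, ?_⟩
  rw [schurMap_eq, hu, ← mul_assoc]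
  exact congrArg (· * u) hv

variable {mu : YoungDiagram}

/-- Permutations fixing `F` are those extended from `lam / mu`, with the same sign, row condition
and column condition. A map intertwining the two signed actions therefore intertwines the frozen
symmetrizers with the skew Schur map. -/
theorem stabSum_apply_of_intertwine {F : Finset (Box lam ⊥)}
    (hF : ∀ b, b ∈ F ↔ ∀ c : Box lam mu, b ≠ c.incl)
    {T : TPow K E (Box lam mu) →ₗ[K] TPow K E (Box lam ⊥)}
    (hT : ∀ σ z, T (signedPerm K E σ z) = signedPerm K E (extPerm σ) (T z))
    (z : TPow K E (Box lam mu)) :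
    (stabSum K (signedPermHom K E _) 1 Box.row F *
      stabSum K (signedPermHom K E _) Equiv.Perm.sign Box.col F) (T z) =
      T (schurMap K E lam mu z) := by
  simp only [stabSum, schurMap, rowSym, colAlt, sum_stabilizer hF, Box.incl_row, Box.incl_col,
    Module.End.mul_apply, LinearMap.comp_apply, LinearMap.sum_apply, LinearMap.smul_apply,
    map_sum, map_smul, hT, sign_extPerm, signedPermHom_apply, MonoidHom.one_apply, Units.val_one,
    Int.cast_one, one_smul]
  congr!

theorem apply_stabSum_of_intertwine {F : Finset (Box lam ⊥)}
    (hF : ∀ b, b ∈ F ↔ ∀ c : Box lam mu, b ≠ c.incl)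
    {T : TPow K E (Box lam ⊥) →ₗ[K] TPow K E (Box lam mu)}
    (hT : ∀ σ z, T (signedPerm K E (extPerm σ) z) = signedPerm K E σ (T z))
    (z : TPow K E (Box lam ⊥)) :
    T ((stabSum K (signedPermHom K E _) 1 Box.row F *
      stabSum K (signedPermHom K E _) Equiv.Perm.sign Box.col F) z) =
      schurMap K E lam mu (T z) := by
  simp only [stabSum, schurMap, rowSym, colAlt, sum_stabilizer hF, Box.incl_row, Box.incl_col,
    Module.End.mul_apply, LinearMap.comp_apply, LinearMap.sum_apply, LinearMap.smul_apply,
    map_sum, map_smul, hT, sign_extPerm, signedPermHom_apply, MonoidHom.one_apply, Units.val_one,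
    Int.cast_one, one_smul]
  congr!

/-- The trace map descends to Schur complexes. -/
theorem exists_apply_insertTrace [FiniteDimensional K E] (h : oneOne ≤ lam) :
    ∃ u : Module.End K (TPow K E (Box lam ⊥)), ∀ z,
      u (insertTrace K E lam (schurMap K E lam oneOne z)) =
        schurMap K E lam ⊥ (insertTrace K E lam z) := by
  obtain ⟨u, hu⟩ := exists_schurMap_eq_mul_col (K := K) (E := E) h
  refine ⟨u, fun z => ?_⟩
  rw [hu, Module.End.mul_apply, stabSum_apply_of_intertwine _ (insertTrace_signedPerm h)]
  intro b
  rw [Finset.mem_insert, Finset.mem_singleton]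
  refine ⟨?_, fun hb => ?_⟩
  · rintro (rfl | rfl) c
    · exact firstColBox_ne_incl h 1 c
    · exact firstColBox_ne_incl h 0 c
  · rcases eq_firstColBox_or h b with hb' | hb' | ⟨c, hc⟩
    · exact Or.inr hb'
    · exact Or.inl hb'
    · exact absurd hc (hb c)

/-- The evaluation map restricts to Schur complexes. -/
theorem evalRow_mem_schur (h : two ≤ lam) :
    ∀ y ∈ schur K E lam ⊥, evalRow K E h y ∈ schur K E lam two := by
  rintro _ ⟨z, rfl⟩
  obtain ⟨u, hu⟩ := exists_schurMap_eq_row_mul (K := K) (E := E) h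
  refine ⟨evalRow K E h (u z), ?_⟩
  rw [hu, Module.End.mul_apply, apply_stabSum_of_intertwine _ (evalRow_signedPerm h)]
  intro b
  rw [Finset.mem_insert, Finset.mem_singleton]
  refine ⟨?_, fun hb => ?_⟩
  · rintro (rfl | rfl) c
    · exact incl_ne_firstRowBox h c 1
    · exact incl_ne_firstRowBox h c 0
  · rcases eq_firstRowBox_or h b with hb' | hb' | ⟨c, hc⟩
    · exact Or.inr hb'
    · exact Or.inl hb'
    · exact absurd hc (hb c)

theorem schurAct_schurProj (X : Vec K E →ₗ[K] Vec K E) (z : TPow K E (Box lam mu)) :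
    schurAct lam mu X (schurProj K E lam mu z) = schurProj K E lam mu (tensorAct X z) :=
  Subtype.ext (LinearMap.congr_fun (tensorAct_schurMap lam mu X) z)

theorem exists_schurProj (x : schur K E lam mu) : ∃ z, schurProj K E lam mu z = x := by
  obtain ⟨_, z, rfl⟩ := x
  exact ⟨z, rfl⟩

theorem schurProj_mem_schurPart {d : ℤ} {z : TPow K E (Box lam mu)}
    (hz : z ∈ tensorPart K E (Box lam mu) d) :
    schurProj K E lam mu z ∈ schurPart K E lam mu d := by
  rw [mem_schurPart]
  change degProj K E _ d (schurMap K E lam mu z) = schurMap K E lam mu z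
  rw [degProj_schurMap, mem_tensorPart.1 hz]

/-- The Schur map commutes with the projections onto homological degrees, so projecting any preimage
gives a homogeneous one. -/
theorem exists_schurProj_of_mem {d : ℤ} {x : schur K E lam mu} (hx : x ∈ schurPart K E lam mu d) :
    ∃ z ∈ tensorPart K E (Box lam mu) d, schurProj K E lam mu z = x := by
  obtain ⟨z, rfl⟩ := exists_schurProj x
  refine ⟨degProj K E _ d z, mem_tensorPart.2 (degProj_degProj d z), Subtype.ext ?_⟩
  rw [mem_schurPart] at hx
  rw [← hx]
  exact (degProj_schurMap d z).symm

end Descent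

end Periplectic

/-! ### The two morphisms and their properties. -/

theorem mainTheorem3 {K E : Type*} [Field K] [CharZero K] [AddCommGroup E] [Module K E]
    [FiniteDimensional K E] (lam : YoungDiagram) :
    (Periplectic.oneOne ≤ lam →
      ∃ f : Periplectic.schur K E lam Periplectic.oneOne →ₗ[K] Periplectic.schur K E lam ⊥,
        (∀ x, f (Periplectic.schurProj K E lam Periplectic.oneOne x) =
          Periplectic.schurProj K E lam ⊥ (Periplectic.insertTrace K E lam x)) ∧
        (∀ X ∈ Periplectic.periplectic K E, ∀ x,
          f (Periplectic.shiftAct lam Periplectic.oneOne X x) =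
            Periplectic.schurAct lam ⊥ X (f x)) ∧
        (∀ d : ℤ, ∀ x ∈ Periplectic.shiftPart K E lam Periplectic.oneOne d,
          f x ∈ Periplectic.schurPart K E lam ⊥ d) ∧
        (lam.colLen 0 ≤ Module.finrank K E + 1 → lam.colLen 1 ≤ Module.finrank K E →
          ∃ x ∈ Periplectic.schurPart K E lam Periplectic.oneOne 0, f x ≠ 0)) ∧
    (∀ h : Periplectic.two ≤ lam,
      ∃ g : Periplectic.schur K E lam ⊥ →ₗ[K] Periplectic.schur K E lam Periplectic.two,
        (∀ y, (g y : Periplectic.TPow K E (Periplectic.Box lam Periplectic.two)) =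
          Periplectic.evalRow K E h y) ∧
        (∀ X ∈ Periplectic.periplectic K E, ∀ y,
          g (Periplectic.schurAct lam ⊥ X y) =
            Periplectic.shiftAct lam Periplectic.two X (g y)) ∧
        (∀ d : ℤ, ∀ y ∈ Periplectic.schurPart K E lam ⊥ d,
          g y ∈ Periplectic.shiftPart K E lam Periplectic.two d) ∧
        (lam.colLen 0 ≤ Module.finrank K E + 1 → lam.colLen 1 ≤ Module.finrank K E →
          ∃ y ∈ Periplectic.schurPart K E lam ⊥ 1, g y ≠ 0)) := by
  refine ⟨fun h => ?_, fun h => ?_⟩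
  · obtain ⟨u, hu⟩ := Periplectic.exists_apply_insertTrace (K := K) (E := E) h
    -- The operator `u` is a noncanonical choice, but `f` does not depend on it: `hf` determines
    -- `f`, because `schurProj` is surjective. The other properties are accordingly checked on
    -- preimages.
    let f : Periplectic.schur K E lam Periplectic.oneOne →ₗ[K] Periplectic.schur K E lam ⊥ :=
      (u ∘ₗ Periplectic.insertTrace K E lam).restrict (by
        rintro _ ⟨z, rfl⟩
        exact ⟨Periplectic.insertTrace K E lam z, (hu z).symm⟩)
    have hf : ∀ z, f (Periplectic.schurProj K E lam Periplectic.oneOne z) =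
        Periplectic.schurProj K E lam ⊥ (Periplectic.insertTrace K E lam z) :=
      fun z => Subtype.ext (hu z)
    refine ⟨f, hf, fun X hX x => ?_, fun d x hx => ?_, fun h0 h1 => ?_⟩
    · obtain ⟨z, rfl⟩ := Periplectic.exists_schurProj x
      rw [Periplectic.shiftAct, Periplectic.schurAct_schurProj, hf, hf,
        Periplectic.schurAct_schurProj]
      exact Subtype.ext (Periplectic.schurMap_tensorAct_insertTrace h hX z).symm
    · obtain ⟨z, hz, rfl⟩ := Periplectic.exists_schurProj_of_mem hx
      rw [hf]
      refine Periplectic.schurProj_mem_schurPart (Periplectic.mem_tensorPart.2 ?_)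
      rw [Periplectic.degProj_insertTrace h, Periplectic.mem_tensorPart.1 hz]
    · obtain ⟨z, hz, hne⟩ := Periplectic.insertTrace_nonzero (K := K) (E := E) h h0 h1
      refine ⟨_, Periplectic.schurProj_mem_schurPart hz, fun hzero => hne ?_⟩
      rw [hf] at hzero
      exact congrArg Subtype.val hzero
  · refine ⟨(Periplectic.evalRow K E h).restrict (Periplectic.evalRow_mem_schur h), fun y => rfl,
      fun X hX y => ?_, fun d y hy => ?_, fun h0 h1 => ?_⟩
    · exact Subtype.ext (Periplectic.evalRow_tensorAct h hX y)
    · rw [Periplectic.mem_schurPart] at hy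
      refine Periplectic.mem_schurPart.2 ((Periplectic.degProj_evalRow h d _).trans ?_)
      exact congrArg _ hy
    · obtain ⟨z, hz, hne⟩ := Periplectic.evalRow_nonzero (K := K) (E := E) h h0 h1
      exact ⟨_, Periplectic.schurProj_mem_schurPart hz, fun hzero =>
        hne (congrArg Subtype.val hzero)⟩
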